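/- Let $\mathbb S^3\times\mathbb R=\{(p_1,\dots,p_5)\in\mathbb E^5:\ p_1^2+p_2^2+p_3^2+p_4^2=1\}$ with the induced (product) Riemannian metric, let $\partial_t=(0,0,0,0,1)$, and let $\theta\in(0,\frac\pi2)$. An immersed surface $M$ in $\mathbb S^3\times\mathbb R$ has constant angle $\theta$ if at each of its points $\partial_t=\sin\theta\,T+\cos\theta\,\xi$ with a unit tangent vector $T$ and a unit normal vector $\xi$ of $M$ in $\mathbb S^3\times\mathbb R$; it is minimal if its mean curvature vector in $\mathbb S^3\times\mathbb R$ vanishes identically. For $\nu_1\in[1,\sqrt{1+\cos^2\theta}]$ put $$F_{\theta,\nu_1}(x,y)=\bigl(c_1\cos(\mu_1x+\nu_2y),\ c_1\sin(\mu_1x+\nu_2y),\ c_2\cos(\mu_2x-\nu_1y),\ c_2\sin(\mu_2x-\nu_1y),\ x\sin\theta\bigr),$$ where $\nu_2,\mu_1,\mu_2,c_1,c_2$ are the nonnegative constants given by $$\nu_2^2=\frac{1+\cos^2\theta-\nu_1^2}{1-\nu_1^2\sin^2\theta},\quad \mu_1^2=\frac{\nu_1^2\cos^4\theta}{1-\nu_1^2\sin^2\theta},\quad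 \mu_2^2=1+\cos^2\theta-\nu_1^2,$$ $$c_1^2=\frac{1-\nu_1^2\sin^2\theta}{1+\cos^2\theta-\nu_1^2\sin^2\theta},\quad c_2^2=\frac{\cos^2\theta}{1+\cos^2\theta-\nu_1^2\sin^2\theta}.$$ Let $M$ be a smooth $2$-manifold and $F:M\to\mathbb S^3\times\mathbb R$ a map. Then $F$ is a smooth immersion which is minimal with constant angle $\theta$ if and only if, up to isometries of $\mathbb S^3\times\mathbb R$, it is locally given by some $F_{\theta,\nu_1}$: for every $p\in M$ there are a constant $\nu_1\in[1,\sqrt{1+\cos^2\theta}]$, an isometry $\Phi$ of $\mathbb S^3\times\mathbb R$ and smooth local coordinates $(x,y)$ of $M$ around $p$ in which $\Phi\circ F=F_{\theta,\nu_1}(x,y)$. If $M$ is connected, then this holds if and only if it holds with one constant $\nu_1$ and one isometry $\Phi$ for all points $p\in M$. -/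

import Mathlib

open scoped Manifold ContDiff

noncomputable section

namespace S3R

/-- Euclidean five-space `𝔼⁵`. -/
abbrev E5 : Type := EuclideanSpace ℝ (Fin 5)

/-- The coordinate plane `ℝ²`, on which surfaces are modelled. -/
abbrev Plane : Type := EuclideanSpace ℝ (Fin 2)

/-- The first four components of a vector of `𝔼⁵`. -/
def horiz (x : E5) : EuclideanSpace ℝ (Fin 4) := WithLp.toLp 2 (fun i => x i.castSucc)

/-- The unit vector `∂/∂t = (0,0,0,0,1)` tangent to the `ℝ`-direction. -/
def dt : E5 := EuclideanSpace.single 4 1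

/-- `𝕊³ × ℝ` as a hypersurface of `𝔼⁵`. -/
def S3xR : Set E5 := {x | ‖horiz x‖ = 1}

/-- The vector `N(x) = (x₁, x₂, x₃, x₄, 0)`, the unit normal of `𝕊³ × ℝ` in `𝔼⁵` at `x`. -/
def unitN (x : E5) : E5 := !₂[x 0, x 1, x 2, x 3, 0]

/-- The tangent space of `𝕊³ × ℝ` at `x`, as a subspace of `𝔼⁵`. -/
def ambientTangent (x : E5) : Submodule ℝ E5 := (Submodule.span ℝ {unitN x})ᗮ

/-- The distance of the Riemannian product `𝕊³ × ℝ`: the geodesic distance of two points of the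
unit sphere is the angle between them, and distances of the two factors add by Pythagoras. -/
def geoDist (x y : S3xR) : ℝ :=
  √ (InnerProductGeometry.angle (horiz x) (horiz y) ^ 2 + ((x : E5) 4 - (y : E5) 4) ^ 2)

/-- Isometries of the Riemannian manifold `𝕊³ × ℝ`: bijections preserving the Riemannian
distance. -/
structure Isom where
  toEquiv : S3xR ≃ S3xR
  geoDist_map : ∀ x y, geoDist (toEquiv x) (toEquiv y) = geoDist x y

variable {M : Type*} [TopologicalSpace M] [ChartedSpace Plane M]

/-- The map `F : M → 𝕊³ × ℝ`, regarded as a map into `𝔼⁵`. -/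
def incl (F : M → S3xR) (p : M) : E5 := (F p : E5)

/-- `F : M → 𝕊³ × ℝ ⊂ 𝔼⁵` is a smooth immersion. -/
def IsImmersed (F : M → S3xR) : Prop :=
  ContMDiff (𝓡 2) 𝓘(ℝ, E5) ∞ (incl F) ∧
    ∀ p : M, Function.Injective (mfderiv (𝓡 2) 𝓘(ℝ, E5) (incl F) p)

/-- The differential of `F` at `p`, in the coordinates of the preferred chart at `p`. -/
def differential (F : M → S3xR) (p : M) : Plane →L[ℝ] E5 :=
  mfderiv (𝓡 2) 𝓘(ℝ, E5) (incl F) p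

/-- The tangent plane `dF(T_pM)` of the surface at `p`. -/
def tangentPlane (F : M → S3xR) (p : M) : Submodule ℝ E5 :=
  LinearMap.range (differential F p).toLinearMap

/-- The normal plane of the surface in `𝕊³ × ℝ` at `p`. -/
def normalPlane (F : M → S3xR) (p : M) : Submodule ℝ E5 :=
  ambientTangent (F p) ⊓ (tangentPlane F p)ᗮ

/-- The surface read in the preferred chart at `p`, as a parametrized surface in `𝔼⁵`. -/
def localParam (F : M → S3xR) (p : M) (u : Plane) : E5 := incl F ((chartAt Plane p).symm u)

/-- The second fundamental form at `p` of the surface in `𝕊³ × ℝ`, in the coordinates of the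
preferred chart at `p`: the normal component in `T(𝕊³ × ℝ)` of the second derivative of `F`.
Its value on coordinate vector fields is the normal part of `∇̃_{∂ᵢ} ∂ⱼ`, since the Levi-Civita
connection `∇̃` of `𝕊³ × ℝ` is the tangential part of the flat connection of `𝔼⁵`. -/
def secondFundamentalForm (F : M → S3xR) (p : M) (v w : Plane) : E5 :=
  (normalPlane F p).starProjection
    (fderiv ℝ (fderiv ℝ (localParam F p)) (chartAt Plane p p) v w)

/-- The `i`-th coordinate vector. -/
def coordVec (i : Fin 2) : Plane := EuclideanSpace.single i 1

/-- The matrix `(g_{ij})` at `p` of the metric induced on the surface, in the preferred chart. -/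
def metricMatrix (F : M → S3xR) (p : M) : Matrix (Fin 2) (Fin 2) ℝ :=
  Matrix.of fun i j => inner ℝ (differential F p (coordVec i)) (differential F p (coordVec j))

/-- The mean curvature vector `H = ½ ∑ g^{ij} h(∂ᵢ, ∂ⱼ)` of the surface in `𝕊³ × ℝ`. -/
def meanCurvature (F : M → S3xR) (p : M) : E5 :=
  (1 / 2 : ℝ) • ∑ i, ∑ j, (metricMatrix F p)⁻¹ i j •
    secondFundamentalForm F p (coordVec i) (coordVec j)

/-- The surface is minimal in `𝕊³ × ℝ`. -/
def IsMinimal (F : M → S3xR) : Prop := ∀ p : M, meanCurvature F p = 0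

/-- The surface has constant angle `θ`: at every point `∂/∂t = sin θ T + cos θ ξ` with a unit
tangent vector `T` and a unit normal vector `ξ` of the surface in `𝕊³ × ℝ`. -/
def HasConstantAngle (F : M → S3xR) (θ : ℝ) : Prop :=
  ∀ p : M, ∃ T ∈ tangentPlane F p, ∃ ξ ∈ normalPlane F p,
    ‖T‖ = 1 ∧ ‖ξ‖ = 1 ∧ dt = Real.sin θ • T + Real.cos θ • ξ

def nu2 (θ ν₁ : ℝ) : ℝ :=
  √ ((1 + Real.cos θ ^ 2 - ν₁ ^ 2) / (1 - ν₁ ^ 2 * Real.sin θ ^ 2))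

def mu1 (θ ν₁ : ℝ) : ℝ :=
  √ (ν₁ ^ 2 * Real.cos θ ^ 4 / (1 - ν₁ ^ 2 * Real.sin θ ^ 2))

def mu2 (θ ν₁ : ℝ) : ℝ := √ (1 + Real.cos θ ^ 2 - ν₁ ^ 2)

def c1 (θ ν₁ : ℝ) : ℝ :=
  √ ((1 - ν₁ ^ 2 * Real.sin θ ^ 2) / (1 + Real.cos θ ^ 2 - ν₁ ^ 2 * Real.sin θ ^ 2))

def c2 (θ ν₁ : ℝ) : ℝ :=
  √ (Real.cos θ ^ 2 / (1 + Real.cos θ ^ 2 - ν₁ ^ 2 * Real.sin θ ^ 2))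

/-- The explicit map `F(x, y)`. -/
def model (θ ν₁ x y : ℝ) : E5 :=
  !₂[c1 θ ν₁ * Real.cos (mu1 θ ν₁ * x + nu2 θ ν₁ * y),
     c1 θ ν₁ * Real.sin (mu1 θ ν₁ * x + nu2 θ ν₁ * y),
     c2 θ ν₁ * Real.cos (mu2 θ ν₁ * x - ν₁ * y),
     c2 θ ν₁ * Real.sin (mu2 θ ν₁ * x - ν₁ * y),
     x * Real.sin θ]

/-- In suitable smooth local coordinates `(x, y)` of `M` around `p`, the map `Φ ∘ F` is the
explicit map with parameters `θ`, `ν₁`. -/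
def IsModelNear (F : M → S3xR) (Φ : Isom) (θ ν₁ : ℝ) (p : M) : Prop :=
  ∃ e ∈ IsManifold.maximalAtlas (𝓡 2) ∞ M, p ∈ e.source ∧
    ∀ q ∈ e.source, (Φ.toEquiv (F q) : E5) = model θ ν₁ (e q 0) (e q 1)

end S3R

end

/-! Write `s = sin θ`, `c = cos θ`, and split the immersion into a map `g` to the sphere and a
height. The unit field `∂ₜ = sT + cξ` is parallel, and differentiating it shows that the second
fundamental form in the direction `ξ` annihilates `T`. It has trace zero by minimality, so it
vanishes. Hence `T` and the unit tangent field `Y ⟂ T` are parallel on the surface, the surface is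
flat, and locally there are Euclidean coordinates `(x, y)` in which the height is `s x`
(`AngleSurface.exists_primitive`, `AngleSurface.exists_coordinates`). There `g_x ⟂ g_y` have lengths
`c` and `1`, and minimality becomes `g_xx + g_yy = -(1 + c²) g`. This is `FlatMinimal`.

Inside the sphere let `a` and `b` be the normal components of `g_xx` and `g_xy`; that of `g_yy` is
`-a`. The Gauss equation is `a² + b² = c²`, and the Codazzi equations say that `(a + ib)²` is
antiholomorphic. Its modulus is constant, so it is constant (`FlatMinimal.exists_normalField`). The
adapted orthonormal frame then has constant connection coefficients, and equal coefficients force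
congruence (`exists_isometry_of_frames`). A change of normal flips `(a, b)` and the reflection `y ↦
-y` flips `b`, so `a²` is the only invariant. It is read off from `|g_xx|² = c⁴ + a²`, and the
explicit family attains every value in `[c⁴, c⁴ + c²]` (`exists_parameter`).

Conversely, an isometry of the ambient space is an orthogonal map times an isometry of the line
(`Isom.exists_eq`). Being locally explicit therefore makes the spherical part `FlatMinimal` and the
height affine in `x`, from which all the geometry is computed (`minimal_of_flatMinimal`). On a
connected surface, two overlapping explicit representations differ by a signed translation of the
plane near a common point. By analyticity their relation persists, so the set where one fixed
representation works is open and closed. -/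

namespace S3R

/-- The four-dimensional Euclidean space containing `𝕊³`. -/
abbrev E4 : Type := EuclideanSpace ℝ (Fin 4)

/-! ### Partial derivatives of maps on the plane -/

section PartialDerivatives

variable {W : Type*} [NormedAddCommGroup W]

/-- The `i`-th partial derivative of a map defined on the plane. -/
noncomputable def pd [NormedSpace ℝ W] (i : Fin 2) (h : Plane → W) (u : Plane) : W :=
  fderiv ℝ h u (coordVec i)

theorem contDiffOn_fderiv [NormedSpace ℝ W] {U : Set Plane} (hU : IsOpen U) {h : Plane → W}
    (hh : ContDiffOn ℝ ∞ h U) : ContDiffOn ℝ ∞ (fderiv ℝ h) U :=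
  hh.fderiv_of_isOpen hU (by simp)

theorem ContDiffOn.pd [NormedSpace ℝ W] {U : Set Plane} (hU : IsOpen U) {h : Plane → W}
    (hh : ContDiffOn ℝ ∞ h U) (i : Fin 2) : ContDiffOn ℝ ∞ (S3R.pd i h) U :=
  (contDiffOn_fderiv hU hh).clm_apply contDiffOn_const

theorem differentiableAt_of_contDiffOn [NormedSpace ℝ W] {U : Set Plane} (hU : IsOpen U)
    {h : Plane → W} (hh : ContDiffOn ℝ ∞ h U) {u : Plane} (hu : u ∈ U) :
    DifferentiableAt ℝ h u :=
  (hh.contDiffAt (hU.mem_nhds hu)).differentiableAt (by simp)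

theorem pd_pd_eq [NormedSpace ℝ W] {U : Set Plane} (hU : IsOpen U) {h : Plane → W}
    (hh : ContDiffOn ℝ ∞ h U) {u : Plane} (hu : u ∈ U) (i j : Fin 2) :
    pd i (pd j h) u = fderiv ℝ (fderiv ℝ h) u (coordVec i) (coordVec j) := by
  have hd := differentiableAt_of_contDiffOn hU (contDiffOn_fderiv hU hh) hu
  unfold pd
  rw [fderiv_clm_apply hd (by fun_prop)]
  simp

theorem fderiv_fderiv_symm [NormedSpace ℝ W] {U : Set Plane} (hU : IsOpen U) {h : Plane → W}
    (hh : ContDiffOn ℝ ∞ h U) {u : Plane} (hu : u ∈ U) (v w : Plane) :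
    fderiv ℝ (fderiv ℝ h) u v w = fderiv ℝ (fderiv ℝ h) u w v :=
  ((hh.contDiffAt (hU.mem_nhds hu)).isSymmSndFDerivAt
    (by simpa using WithTop.coe_le_coe.2 (le_top (a := (2 : ℕ∞))))) v w

theorem pd_comm [NormedSpace ℝ W] {U : Set Plane} (hU : IsOpen U) {h : Plane → W}
    (hh : ContDiffOn ℝ ∞ h U) {u : Plane} (hu : u ∈ U) (i j : Fin 2) :
    pd i (pd j h) u = pd j (pd i h) u := by
  rw [pd_pd_eq hU hh hu, pd_pd_eq hU hh hu, fderiv_fderiv_symm hU hh hu]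

theorem pd_congr [NormedSpace ℝ W] {U : Set Plane} (hU : IsOpen U) {h k : Plane → W}
    (hk : ∀ u ∈ U, h u = k u) {u : Plane} (hu : u ∈ U) (i : Fin 2) : pd i h u = pd i k u := by
  unfold pd
  rw [Filter.EventuallyEq.fderiv_eq (Filter.eventuallyEq_of_mem (hU.mem_nhds hu) hk)]

theorem pd_eq_zero [NormedSpace ℝ W] {U : Set Plane} (hU : IsOpen U) {h : Plane → W} {k : W}
    (hk : ∀ u ∈ U, h u = k) {u : Plane} (hu : u ∈ U) (i : Fin 2) : pd i h u = 0 := by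
  rw [pd_congr hU hk hu]
  simp [pd]

theorem pd_add [NormedSpace ℝ W] {h k : Plane → W} {u : Plane} (hh : DifferentiableAt ℝ h u)
    (hk : DifferentiableAt ℝ k u) (i : Fin 2) :
    pd i (fun u => h u + k u) u = pd i h u + pd i k u := by
  simp [pd, fderiv_fun_add hh hk]

theorem pd_const_smul [NormedSpace ℝ W] {h : Plane → W} {u : Plane}
    (hh : DifferentiableAt ℝ h u) (r : ℝ) (i : Fin 2) :
    pd i (fun u => r • h u) u = r • pd i h u := by
  simp [pd, fderiv_fun_const_smul hh]

theorem fderiv_eq_zero_of_pd [NormedSpace ℝ W] {h : Plane → W} {u : Plane}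
    (h0 : ∀ i, pd i h u = 0) : fderiv ℝ h u = 0 := by
  ext z
  have hz : z = ∑ i, z i • coordVec i := by
    ext j; fin_cases j <;> simp [coordVec]
  rw [hz, map_sum]
  refine Finset.sum_eq_zero fun i _ => ?_
  rw [map_smul]
  have := h0 i
  unfold pd at this
  rw [this, smul_zero]

theorem exists_const_of_pd [NormedSpace ℝ W] {U : Set Plane} (hU : IsOpen U)
    (hc : IsPreconnected U) {h : Plane → W} (hh : ContDiffOn ℝ ∞ h U)
    (h0 : ∀ u ∈ U, ∀ i, pd i h u = 0) : ∃ k, ∀ u ∈ U, h u = k :=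
  hU.exists_is_const_of_fderiv_eq_zero hc (hh.differentiableOn (by simp))
    fun u hu => fderiv_eq_zero_of_pd (h0 u hu)

variable [InnerProductSpace ℝ W]

theorem pd_inner {p q : Plane → W} {u : Plane} (hp : DifferentiableAt ℝ p u)
    (hq : DifferentiableAt ℝ q u) (i : Fin 2) :
    pd i (fun u => inner ℝ (p u) (q u)) u
      = inner ℝ (pd i p u) (q u) + inner ℝ (p u) (pd i q u) := by
  unfold pd
  rw [fderiv_inner_apply ℝ hp hq, add_comm]

theorem inner_pd_add_inner_pd {U : Set Plane} (hU : IsOpen U) {p q : Plane → W}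
    (hp : ContDiffOn ℝ ∞ p U) (hq : ContDiffOn ℝ ∞ q U) {k : ℝ}
    (hk : ∀ u ∈ U, inner ℝ (p u) (q u) = k) (i : Fin 2) {u : Plane} (hu : u ∈ U) :
    inner ℝ (pd i p u) (q u) + inner ℝ (p u) (pd i q u) = 0 := by
  rw [← pd_inner (differentiableAt_of_contDiffOn hU hp hu)
    (differentiableAt_of_contDiffOn hU hq hu), pd_eq_zero hU hk hu]

end PartialDerivatives

/-! ### Flat minimal maps to the sphere: Gauss and Codazzi equations -/

/-- Only one dimension of `𝔼⁴` is left for `A` and `B`, so Cauchy–Schwarz is an equality. Otherwise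
the Gram–Schmidt remainder `C` of `B` against `A` would be a fifth nonzero orthogonal vector. -/
theorem inner_sq_eq_of_orthogonal {e₁ e₂ e₃ A B : E4} (h₁ : e₁ ≠ 0) (h₂ : e₂ ≠ 0) (h₃ : e₃ ≠ 0)
    (h₁₂ : inner ℝ e₁ e₂ = 0) (h₁₃ : inner ℝ e₁ e₃ = 0) (h₂₃ : inner ℝ e₂ e₃ = 0)
    (hA₁ : inner ℝ e₁ A = 0) (hA₂ : inner ℝ e₂ A = 0) (hA₃ : inner ℝ e₃ A = 0)
    (hB₁ : inner ℝ e₁ B = 0) (hB₂ : inner ℝ e₂ B = 0) (hB₃ : inner ℝ e₃ B = 0) :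
    inner ℝ A B ^ 2 = inner ℝ A A * inner ℝ B B := by
  by_cases hA : A = 0
  · simp [hA]
  set C : E4 := (inner ℝ A A : ℝ) • B - (inner ℝ A B : ℝ) • A with hC
  have hCA : inner ℝ A C = 0 := by
    simp only [hC, inner_sub_right, inner_smul_right]; ring
  have hCC : inner ℝ C C = inner ℝ A A * (inner ℝ A A * inner ℝ B B - inner ℝ A B ^ 2) := by
    simp only [hC, inner_sub_right, inner_sub_left, inner_smul_right, inner_smul_left,
      real_inner_comm A B, conj_trivial]
    ring
  have hAA : (inner ℝ A A : ℝ) ≠ 0 := by simpa using hA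
  by_cases hC0 : C = 0
  · rw [hC0, inner_zero_left, eq_comm, mul_eq_zero] at hCC
    rcases hCC with h | h
    · exact absurd h hAA
    · linarith
  exfalso
  have hC₁ : inner ℝ e₁ C = 0 := by simp [hC, inner_sub_right, inner_smul_right, hA₁, hB₁]
  have hC₂ : inner ℝ e₂ C = 0 := by simp [hC, inner_sub_right, inner_smul_right, hA₂, hB₂]
  have hC₃ : inner ℝ e₃ C = 0 := by simp [hC, inner_sub_right, inner_smul_right, hA₃, hB₃]
  have hli : LinearIndependent ℝ ![e₁, e₂, e₃, A, C] := by
    refine linearIndependent_of_ne_zero_of_inner_eq_zero ?_ ?_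
    · intro i; fin_cases i <;> simp [h₁, h₂, h₃, hA, hC0]
    · intro i j hij
      fin_cases i <;> fin_cases j <;>
        first
        | exact absurd rfl hij
        | (simp [h₁₂, h₁₃, h₂₃, hA₁, hA₂, hA₃, hC₁, hC₂, hC₃, hCA]; done)
        | rw [real_inner_comm]; simp [h₁₂, h₁₃, h₂₃, hA₁, hA₂, hA₃, hC₁, hC₂, hC₃, hCA]
  have := hli.fintype_card_le_finrank
  simp at this

/-- A map from an open set of the plane to `𝕊³ ⊂ 𝔼⁴` which is the first factor of an isometric
parametrization of a minimal surface of `𝕊³ × ℝ` whose angle has cosine `c`. -/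
structure FlatMinimal (c : ℝ) (g : Plane → E4) (U : Set Plane) : Prop where
  isOpen : IsOpen U
  smooth : ContDiffOn ℝ ∞ g U
  unit : ∀ u ∈ U, inner ℝ (g u) (g u) = 1
  xx : ∀ u ∈ U, inner ℝ (pd 0 g u) (pd 0 g u) = c ^ 2
  xy : ∀ u ∈ U, inner ℝ (pd 0 g u) (pd 1 g u) = 0
  yy : ∀ u ∈ U, inner ℝ (pd 1 g u) (pd 1 g u) = 1
  harmonic : ∀ u ∈ U, pd 0 (pd 0 g) u + pd 1 (pd 1 g) u = -(1 + c ^ 2) • g u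

/-- Pointwise form of the fact that a holomorphic or antiholomorphic function of constant nonzero
modulus is constant. -/
theorem eq_neg_of_sq_add_sq {P Q c Px Py Qx Qy : ℝ} (hc : c ≠ 0) (hPQ : P ^ 2 + Q ^ 2 = c ^ 4)
    (hx : P * Px + Q * Qx = 0) (hy : P * Py + Q * Qy = 0) (h₁ : Px = -Qy) (h₂ : Py = Qx) :
    Px = 0 ∧ Py = 0 := by
  have h4 : c ^ 4 ≠ 0 := pow_ne_zero _ hc
  have a : c ^ 4 * Px = 0 := by
    rw [← hPQ]; subst h₁ h₂; linear_combination P * hx - Q * hy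
  have b : c ^ 4 * Py = 0 := by
    rw [← hPQ]; subst h₁ h₂; linear_combination P * hy + Q * hx
  exact ⟨(mul_eq_zero.1 a).resolve_left h4, (mul_eq_zero.1 b).resolve_left h4⟩

theorem exists_sq_sq_mul {α β γ : ℝ} (hα : 0 ≤ α) (hβ : 0 ≤ β) (h : γ ^ 2 = α * β) :
    ∃ a b : ℝ, a ^ 2 = α ∧ b ^ 2 = β ∧ a * b = γ := by
  have hm : √α * √β = |γ| := by rw [← Real.sqrt_mul hα, ← h, Real.sqrt_sq_eq_abs]
  rcases le_total 0 γ with hγ | hγ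
  · exact ⟨√α, √β, Real.sq_sqrt hα, Real.sq_sqrt hβ, by rw [hm, abs_of_nonneg hγ]⟩
  · exact ⟨√α, -√β, Real.sq_sqrt hα, by rw [neg_sq, Real.sq_sqrt hβ], by
      rw [mul_neg, hm, abs_of_nonpos hγ, neg_neg]⟩

namespace FlatMinimal

variable {c : ℝ} {g : Plane → E4} {U : Set Plane}

/-- The unit normal of a flat minimal map, together with the (constant) coefficients of the
second fundamental form. -/
structure IsNormalField (c : ℝ) (g : Plane → E4) (U : Set Plane) (a b : ℝ) (η : Plane → E4) :
    Prop where
  smooth : ContDiffOn ℝ ∞ η U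
  unit : ∀ u ∈ U, inner ℝ (η u) (η u) = 1
  pos : ∀ u ∈ U, inner ℝ (g u) (η u) = 0
  x : ∀ u ∈ U, inner ℝ (pd 0 g u) (η u) = 0
  y : ∀ u ∈ U, inner ℝ (pd 1 g u) (η u) = 0
  xx : ∀ u ∈ U, pd 0 (pd 0 g) u = -c ^ 2 • g u + a • η u
  xy : ∀ u ∈ U, pd 0 (pd 1 g) u = b • η u

theorem exists_normalField (h : FlatMinimal c g U) (hc : c ≠ 0) (hU : IsPreconnected U)
    (hne : U.Nonempty) :
    ∃ a b η, a ^ 2 + b ^ 2 = c ^ 2 ∧ IsNormalField c g U a b η := by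
  have ho := h.isOpen
  have s0 := h.smooth
  have sx := ContDiffOn.pd ho s0 0
  have sy := ContDiffOn.pd ho s0 1
  have sxx := ContDiffOn.pd ho sx 0
  have sxy := ContDiffOn.pd ho sy 0
  have syy := ContDiffOn.pd ho sy 1
  have hyx : ∀ u ∈ U, pd 1 (pd 0 g) u = pd 0 (pd 1 g) u := fun u hu => pd_comm ho s0 hu _ _
  have gx : ∀ u ∈ U, inner ℝ (g u) (pd 0 g u) = 0 := fun u hu => by
    have := inner_pd_add_inner_pd ho s0 s0 h.unit 0 hu
    rw [real_inner_comm] at this; linarith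
  have gy : ∀ u ∈ U, inner ℝ (g u) (pd 1 g u) = 0 := fun u hu => by
    have := inner_pd_add_inner_pd ho s0 s0 h.unit 1 hu
    rw [real_inner_comm] at this; linarith
  have x_xx : ∀ u ∈ U, inner ℝ (pd 0 g u) (pd 0 (pd 0 g) u) = 0 := fun u hu => by
    have := inner_pd_add_inner_pd ho sx sx h.xx 0 hu
    rw [real_inner_comm] at this; linarith
  have x_xy : ∀ u ∈ U, inner ℝ (pd 0 g u) (pd 0 (pd 1 g) u) = 0 := fun u hu => by
    have := inner_pd_add_inner_pd ho sx sx h.xx 1 hu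
    rw [real_inner_comm, hyx u hu] at this; linarith
  have y_xy : ∀ u ∈ U, inner ℝ (pd 1 g u) (pd 0 (pd 1 g) u) = 0 := fun u hu => by
    have := inner_pd_add_inner_pd ho sy sy h.yy 0 hu
    rw [real_inner_comm] at this; linarith
  have xx_y : ∀ u ∈ U, inner ℝ (pd 0 (pd 0 g) u) (pd 1 g u) = 0 := fun u hu => by
    have := inner_pd_add_inner_pd ho sx sy h.xy 0 hu
    rw [x_xy u hu] at this; linarith
  have g_xx : ∀ u ∈ U, inner ℝ (g u) (pd 0 (pd 0 g) u) = -c ^ 2 := fun u hu => by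
    have := inner_pd_add_inner_pd ho s0 sx gx 0 hu
    rw [h.xx u hu] at this; linarith
  have g_xy : ∀ u ∈ U, inner ℝ (g u) (pd 0 (pd 1 g) u) = 0 := fun u hu => by
    have := inner_pd_add_inner_pd ho s0 sy gy 0 hu
    rw [h.xy u hu] at this; linarith
  -- the normal parts of the second derivatives
  set A : Plane → E4 := fun u => pd 0 (pd 0 g) u + c ^ 2 • g u with hA
  set B : Plane → E4 := fun u => pd 0 (pd 1 g) u with hB
  have sA : ContDiffOn ℝ ∞ A U := sxx.add (s0.const_smul _)
  have sB : ContDiffOn ℝ ∞ B U := sxy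
  have hyy : ∀ u ∈ U, pd 1 (pd 1 g) u = -(1 : ℝ) • g u + -(1 : ℝ) • A u := fun u hu => by
    have := h.harmonic u hu
    rw [eq_comm, ← sub_eq_iff_eq_add'] at this
    rw [← this, hA]; module
  have gA : ∀ u ∈ U, inner ℝ (g u) (A u) = 0 := fun u hu => by
    rw [hA, inner_add_right, inner_smul_right, g_xx u hu, h.unit u hu]; ring
  have xA : ∀ u ∈ U, inner ℝ (pd 0 g u) (A u) = 0 := fun u hu => by
    rw [hA, inner_add_right, inner_smul_right, x_xx u hu, real_inner_comm, gx u hu]; simp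
  have yA : ∀ u ∈ U, inner ℝ (pd 1 g u) (A u) = 0 := fun u hu => by
    rw [hA, inner_add_right, inner_smul_right, real_inner_comm, xx_y u hu, real_inner_comm,
      gy u hu]; simp
  have par : ∀ u ∈ U, inner ℝ (A u) (B u) ^ 2 = inner ℝ (A u) (A u) * inner ℝ (B u) (B u) :=
    fun u hu => by
    refine inner_sq_eq_of_orthogonal (e₁ := g u) (e₂ := pd 0 g u) (e₃ := pd 1 g u) ?_ ?_ ?_
      (gx u hu) (gy u hu) (h.xy u hu) (gA u hu) (xA u hu) (yA u hu) (g_xy u hu) (x_xy u hu)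
      (y_xy u hu)
    · intro h0; simpa [h0] using h.unit u hu
    · intro h0; have := h.xx u hu
      rw [h0, inner_zero_left, eq_comm] at this; exact pow_ne_zero 2 hc this
    · intro h0; simpa [h0] using h.yy u hu
  -- Gauss equation of a flat metric: differentiate `⟨g_xx, g_y⟩ = 0` in `y` and `⟨g_xy, g_y⟩ = 0`
  -- in `x`. The third derivatives agree, which leaves `⟨g_xx, g_yy⟩ = |g_xy|²`.
  have gauss : ∀ u ∈ U, inner ℝ (A u) (A u) + inner ℝ (B u) (B u) = c ^ 2 := fun u hu => by
    have e1 := inner_pd_add_inner_pd ho sxx sy xx_y 1 hu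
    have xy_y : ∀ u ∈ U, inner ℝ (pd 0 (pd 1 g) u) (pd 1 g u) = 0 := fun u hu => by
      rw [real_inner_comm, y_xy u hu]
    have e2 := inner_pd_add_inner_pd ho sxy sy xy_y 0 hu
    rw [pd_comm ho sx hu, pd_congr ho hyx hu] at e1
    have e3 : inner ℝ (pd 0 (pd 0 g) u) (pd 1 (pd 1 g) u) = c ^ 2 - inner ℝ (A u) (A u) := by
      have : pd 0 (pd 0 g) u = A u + (-c ^ 2) • g u := by rw [hA]; module
      rw [hyy u hu, this]
      simp only [inner_add_left, inner_add_right, inner_smul_left, inner_smul_right, gA u hu,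
        h.unit u hu, real_inner_comm (g u) (A u), conj_trivial]
      ring
    rw [e3] at e1
    linarith
  -- `Ay` and `By` are the Codazzi equations, with tangential terms that disappear after pairing
  -- with `A` or `B`.
  have Ay : ∀ u ∈ U, pd 1 A u = pd 0 B u + c ^ 2 • pd 1 g u := fun u hu => by
    rw [hA, pd_add (differentiableAt_of_contDiffOn ho sxx hu)
      (differentiableAt_of_contDiffOn ho (s0.const_smul _) hu),
      pd_const_smul (differentiableAt_of_contDiffOn ho s0 hu), pd_comm ho sx hu,
      pd_congr ho hyx hu]
  have By : ∀ u ∈ U, pd 1 B u = -(1 : ℝ) • pd 0 g u + -(1 : ℝ) • pd 0 A u := fun u hu => by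
    rw [hB]
    change pd 1 (pd 0 (pd 1 g)) u = _
    rw [pd_comm ho sy hu, pd_congr ho hyy hu,
      pd_add (differentiableAt_of_contDiffOn ho (s0.const_smul _) hu)
      (differentiableAt_of_contDiffOn ho (sA.const_smul _) hu),
      pd_const_smul (differentiableAt_of_contDiffOn ho s0 hu),
      pd_const_smul (differentiableAt_of_contDiffOn ho sA hu)]
  have dA : ∀ u ∈ U, DifferentiableAt ℝ A u := fun u hu => differentiableAt_of_contDiffOn ho sA hu
  have dB : ∀ u ∈ U, DifferentiableAt ℝ B u := fun u hu => differentiableAt_of_contDiffOn ho sB hu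
  -- `P = a²` and `Q = ab` are quadratic in the normal, hence smooth and independent of its sign.
  -- With the Gauss equation, `(2P - c²) + 2iQ = (a + ib)²`.
  set P : Plane → ℝ := fun u => inner ℝ (A u) (A u) with hP
  set Q : Plane → ℝ := fun u => inner ℝ (A u) (B u) with hQ
  have sP : ContDiffOn ℝ ∞ P U := sA.inner ℝ sA
  have sQ : ContDiffOn ℝ ∞ Q U := sA.inner ℝ sB
  have pdP : ∀ i, ∀ u ∈ U, pd i P u = 2 * inner ℝ (A u) (pd i A u) := fun i u hu => by
    rw [hP, pd_inner (dA u hu) (dA u hu), real_inner_comm]; ring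
  have pdQ : ∀ i, ∀ u ∈ U, pd i Q u = inner ℝ (B u) (pd i A u) + inner ℝ (A u) (pd i B u) :=
    fun i u hu => by rw [hQ, pd_inner (dA u hu) (dB u hu), real_inner_comm]
  have pdP' : ∀ i, ∀ u ∈ U, pd i P u = -2 * inner ℝ (B u) (pd i B u) := fun i u hu => by
    have e : ∀ u ∈ U, P u + inner ℝ (B u) (B u) = c ^ 2 := gauss
    have := pd_eq_zero ho e hu i
    rw [pd_add (differentiableAt_of_contDiffOn ho sP hu)
      (differentiableAt_of_contDiffOn ho (sB.inner ℝ sB) hu), pd_inner (dB u hu) (dB u hu),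
      real_inner_comm] at this
    linarith
  have xA' : ∀ u ∈ U, inner ℝ (A u) (pd 0 g u) = 0 := fun u hu => by
    rw [real_inner_comm, xA u hu]
  have yA' : ∀ u ∈ U, inner ℝ (A u) (pd 1 g u) = 0 := fun u hu => by
    rw [real_inner_comm, yA u hu]
  have xB' : ∀ u ∈ U, inner ℝ (B u) (pd 0 g u) = 0 := fun u hu => by
    rw [real_inner_comm, hB, x_xy u hu]
  have yB' : ∀ u ∈ U, inner ℝ (B u) (pd 1 g u) = 0 := fun u hu => by
    rw [real_inner_comm, hB, y_xy u hu]
  -- The derivative of `P` is taken once as that of `|A|²` and once as that of `-|B|²`. Half the sum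
  -- of the two expressions is what Codazzi gives for the derivative of `Q`, up to sign.
  have CR : ∀ u ∈ U, pd 0 P u = -pd 1 Q u ∧ pd 1 P u = pd 0 Q u := fun u hu => by
    refine ⟨?_, ?_⟩
    · have h1 := pdP 0 u hu
      have h2 := pdP' 0 u hu
      rw [pdQ 1 u hu, Ay u hu, By u hu]
      simp only [inner_add_right, inner_smul_right, xA' u hu, yB' u hu]
      linarith
    · have h1 := pdP 1 u hu
      have h2 := pdP' 1 u hu
      rw [Ay u hu] at h1
      rw [By u hu] at h2
      rw [pdQ 0 u hu]
      simp only [inner_add_right, inner_smul_right, yA' u hu, xB' u hu] at h1 h2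
      linarith
  have hconst : ∀ u ∈ U, ∀ i, (pd i P u = 0 ∧ pd i Q u = 0) := by
    intro u hu
    have e : ∀ u ∈ U, Q u * Q u + P u * (P u + -c ^ 2) = 0 := fun u hu => by
      have h1 := par u hu
      have h2 := gauss u hu
      simp only [hP, hQ]
      rw [← h2]; linear_combination h1
    have key : ∀ i, (2 * P u - c ^ 2) * (2 * pd i P u) + (2 * Q u) * (2 * pd i Q u) = 0 := by
      intro i
      have := pd_eq_zero ho e hu i
      have dP := differentiableAt_of_contDiffOn ho sP hu
      have dQ := differentiableAt_of_contDiffOn ho sQ hu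
      rw [pd, fderiv_fun_add (dQ.fun_mul dQ) (dP.fun_mul (dP.add_const _)), fderiv_fun_mul dQ dQ,
        fderiv_fun_mul dP (dP.add_const _), fderiv_add_const] at this
      simp only [add_apply, smul_apply, smul_eq_mul]
        at this
      simp only [pd]
      linear_combination 2 * this
    have hPQ : (2 * P u - c ^ 2) ^ 2 + (2 * Q u) ^ 2 = c ^ 4 := by
      linear_combination 4 * e u hu
    obtain ⟨c1, c2⟩ := CR u hu
    obtain ⟨r1, r2⟩ := eq_neg_of_sq_add_sq hc hPQ (key 0) (key 1) (by rw [c1]; ring)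
      (by rw [c2])
    intro i
    fin_cases i
    · exact ⟨by simpa using r1, by simpa [← c2] using r2⟩
    · exact ⟨by simpa using r2, by
        have : pd 1 Q u = -pd 0 P u := by rw [c1]; ring
        rw [Fin.mk_one, this]; simpa using r1⟩
  obtain ⟨α, hα⟩ := exists_const_of_pd ho hU sP fun u hu i => (hconst u hu i).1
  obtain ⟨γ, hγ⟩ := exists_const_of_pd ho hU sQ fun u hu i => (hconst u hu i).2
  have hβ : ∀ u ∈ U, inner ℝ (B u) (B u) = c ^ 2 - α := fun u hu => by
    have := gauss u hu
    have h2 := hα u hu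
    simp only [hP] at h2
    linarith
  obtain ⟨u₀, hu₀⟩ := hne
  -- The signs of the two roots must be chosen jointly, to reproduce the constant `⟨A, B⟩`.
  obtain ⟨a, b, ha, hb, hab⟩ : ∃ a b : ℝ, a ^ 2 = α ∧ b ^ 2 = c ^ 2 - α ∧ a * b = γ := by
    refine exists_sq_sq_mul ?_ ?_ ?_
    · rw [← hα u₀ hu₀]; exact real_inner_self_nonneg
    · rw [← hβ u₀ hu₀]; exact real_inner_self_nonneg
    · rw [← hβ u₀ hu₀, ← hα u₀ hu₀, ← hγ u₀ hu₀]; exact par u₀ hu₀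
  have hc2 : c ^ 2 ≠ 0 := pow_ne_zero _ hc
  have hAA : ∀ u ∈ U, inner ℝ (A u) (A u) = a ^ 2 := fun u hu => by rw [ha]; exact hα u hu
  have hAB : ∀ u ∈ U, inner ℝ (A u) (B u) = a * b := fun u hu => by rw [hab]; exact hγ u hu
  have hBA : ∀ u ∈ U, inner ℝ (B u) (A u) = a * b := fun u hu => by
    rw [real_inner_comm]; exact hAB u hu
  have hBB : ∀ u ∈ U, inner ℝ (B u) (B u) = b ^ 2 := fun u hu => by rw [hb]; exact hβ u hu
  have hsum : a ^ 2 + b ^ 2 = c ^ 2 := by rw [ha, hb]; ring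
  have hprop : ∀ u ∈ U, b • A u = a • B u := fun u hu => by
    rw [← sub_eq_zero, ← inner_self_eq_zero (𝕜 := ℝ)]
    simp only [inner_sub_left, inner_sub_right, inner_smul_left, inner_smul_right, hAA u hu,
      hAB u hu, hBA u hu, hBB u hu, conj_trivial]
    ring
  -- If `A = a η` and `B = b η`, then `aA + bB = (a² + b²) η = c² η`. This recovers `η` smoothly
  -- even when one of `A`, `B` is zero.
  refine ⟨a, b, fun u => (c ^ 2)⁻¹ • (a • A u + b • B u), hsum, ?_, ?_, ?_, ?_, ?_, ?_, ?_⟩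
  · exact ((sA.const_smul _).add (sB.const_smul _)).const_smul _
  · intro u hu
    simp only [inner_add_left, inner_add_right, inner_smul_left, inner_smul_right, hAA u hu,
      hAB u hu, hBA u hu, hBB u hu, conj_trivial]
    rw [inv_mul_eq_iff_eq_mul₀ hc2]
    field_simp
    linear_combination (a ^ 2 + b ^ 2 + c ^ 2) * hsum
  · intro u hu
    simp [inner_add_right, inner_smul_right, gA u hu, hB, g_xy u hu]
  · intro u hu
    simp [inner_add_right, inner_smul_right, xA u hu, hB, x_xy u hu]
  · intro u hu
    simp [inner_add_right, inner_smul_right, yA u hu, hB, y_xy u hu]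
  · intro u hu
    have : a • (c ^ 2)⁻¹ • (a • A u + b • B u) = A u := by
      have : a • (a • A u + b • B u) = c ^ 2 • A u := by
        rw [smul_add, smul_comm a b, ← hprop u hu, ← hsum]; module
      rw [smul_comm, this, smul_smul, inv_mul_cancel₀ hc2, one_smul]
    rw [this, hA]; module
  · intro u hu
    have : b • (a • A u + b • B u) = c ^ 2 • B u := by
      rw [smul_add, smul_comm b a, hprop u hu, ← hsum]; module
    rw [smul_comm, this, smul_smul, inv_mul_cancel₀ hc2, one_smul]

end FlatMinimal

end S3R

/-! ### Moving frames and congruence of flat minimal maps -/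

namespace S3R

/-- An orthonormal family of four vectors of `𝔼⁴`, as an orthonormal basis. -/
noncomputable def orthonormalBasisOfFour {v : Fin 4 → E4} (h : Orthonormal ℝ v) :
    OrthonormalBasis (Fin 4) ℝ E4 :=
  OrthonormalBasis.mk h (h.linearIndependent.span_eq_top_of_card_eq_finrank (by simp)).ge

theorem sum_inner_smul_of_orthonormal {v : Fin 4 → E4} (h : Orthonormal ℝ v) (x : E4) :
    ∑ i, (inner ℝ (v i) x : ℝ) • v i = x := by
  simpa [orthonormalBasisOfFour] using (orthonormalBasisOfFour h).sum_repr' x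

/-- The linear map `v ↦ ∑ ⟨Eᵢ(u), v⟩ E'ᵢ(u)` carries one frame to the other at `u`. Its derivative
in `u` vanishes because the common connection matrix is skew, so it does not depend on `u`. Skewness
is also why the coefficients are compared only for `i < j`. -/
theorem exists_isometry_of_frames {U : Set Plane} (hU : IsOpen U) (hc : IsPreconnected U)
    (hne : U.Nonempty) {E E' : Fin 4 → Plane → E4} (sE : ∀ i, ContDiffOn ℝ ∞ (E i) U)
    (sE' : ∀ i, ContDiffOn ℝ ∞ (E' i) U) (oE : ∀ u ∈ U, Orthonormal ℝ fun i => E i u)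
    (oE' : ∀ u ∈ U, Orthonormal ℝ fun i => E' i u)
    (hEE' : ∀ u ∈ U, ∀ k i j, i < j →
      (inner ℝ (pd k (E i) u) (E j u) : ℝ) = inner ℝ (pd k (E' i) u) (E' j u)) :
    ∃ L : E4 ≃ₗᵢ[ℝ] E4, ∀ u ∈ U, ∀ i, L (E i u) = E' i u := by
  have skew : ∀ {D : Fin 4 → Plane → E4}, (∀ i, ContDiffOn ℝ ∞ (D i) U) →
      (∀ u ∈ U, Orthonormal ℝ fun i => D i u) → ∀ u ∈ U, ∀ k i j,
      (inner ℝ (pd k (D i) u) (D j u) : ℝ) = -inner ℝ (pd k (D j) u) (D i u) := by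
    intro D sD oD u hu k i j
    have := inner_pd_add_inner_pd hU (sD i) (sD j) (k := if i = j then 1 else 0)
      (fun u hu => orthonormal_iff_ite.1 (oD u hu) i j) k hu
    rw [real_inner_comm (D i u)]
    linarith
  have full : ∀ u ∈ U, ∀ k i j,
      (inner ℝ (pd k (E i) u) (E j u) : ℝ) = inner ℝ (pd k (E' i) u) (E' j u) := by
    intro u hu k i j
    rcases lt_trichotomy i j with h | h | h
    · exact hEE' u hu k i j h
    · subst h
      have h1 := skew sE oE u hu k i i
      have h2 := skew sE' oE' u hu k i i
      linarith
    · rw [skew sE oE u hu, skew sE' oE' u hu, hEE' u hu k j i h]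
  have key : ∀ v, ∃ w, ∀ u ∈ U, ∑ i, (inner ℝ (E i u) v : ℝ) • E' i u = w := by
    intro v
    refine exists_const_of_pd hU hc (h := fun u => ∑ i, (inner ℝ (E i u) v : ℝ) • E' i u) ?_ ?_
    · exact ContDiffOn.sum fun i _ => ((sE i).inner ℝ contDiffOn_const).smul (sE' i)
    · intro u hu k
      have dE := fun i => differentiableAt_of_contDiffOn hU (sE i) hu
      have dE' := fun i => differentiableAt_of_contDiffOn hU (sE' i) hu
      have e1 : ∀ i, pd k (fun u => (inner ℝ (E i u) v : ℝ) • E' i u) u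
          = ∑ j, ((inner ℝ (pd k (E i) u) (E j u) * inner ℝ (E j u) v : ℝ) • E' i u
            + (inner ℝ (pd k (E i) u) (E j u) * inner ℝ (E i u) v : ℝ) • E' j u) := by
        intro i
        have h1 : pd k (fun u => (inner ℝ (E i u) v : ℝ) • E' i u) u
            = (inner ℝ (E i u) v : ℝ) • pd k (E' i) u
              + (inner ℝ (pd k (E i) u) v : ℝ) • E' i u := by
          have := pd_inner (dE i) (differentiableAt_const v) k
          simp only [pd, fderiv_fun_const, Pi.zero_apply, zero_apply, inner_zero_right,
            add_zero] at this
          rw [pd, fderiv_fun_smul ((dE i).inner ℝ (differentiableAt_const v)) (dE' i)]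
          simp [pd, this]
        rw [h1, Finset.sum_add_distrib, add_comm]
        congr 1
        · rw [← Finset.sum_smul]
          congr 1
          nth_rewrite 1 [← sum_inner_smul_of_orthonormal (oE u hu) (pd k (E i) u)]
          rw [sum_inner]
          exact Finset.sum_congr rfl fun j _ => by
            rw [inner_smul_left, real_inner_comm]; rfl
        · nth_rewrite 1 [← sum_inner_smul_of_orthonormal (oE' u hu) (pd k (E' i) u)]
          rw [Finset.smul_sum]
          exact Finset.sum_congr rfl fun j _ => by
            rw [full u hu, smul_smul, mul_comm, real_inner_comm]
      have e2 : pd k (fun u => ∑ i, (inner ℝ (E i u) v : ℝ) • E' i u) u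
          = ∑ i, pd k (fun u => (inner ℝ (E i u) v : ℝ) • E' i u) u := by
        rw [pd, fderiv_fun_sum fun i _ =>
          ((dE i).inner ℝ (differentiableAt_const v)).fun_smul (dE' i)]
        simp [pd]
      rw [e2, Finset.sum_congr rfl fun i _ => e1 i]
      simp only [Finset.sum_add_distrib]
      nth_rewrite 2 [Finset.sum_comm]
      rw [← Finset.sum_add_distrib]
      refine Finset.sum_eq_zero fun i _ => ?_
      rw [← Finset.sum_add_distrib]
      refine Finset.sum_eq_zero fun j _ => ?_
      rw [skew sE oE u hu k j i]
      module
  obtain ⟨u₀, hu₀⟩ := hne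
  refine ⟨(orthonormalBasisOfFour (oE u₀ hu₀)).equiv (orthonormalBasisOfFour (oE' u₀ hu₀))
    (Equiv.refl _), fun u hu j => ?_⟩
  obtain ⟨w, hw⟩ := key (E j u)
  have h1 := hw u hu
  have h0 := hw u₀ hu₀
  have h2 : ∑ i, (inner ℝ (E i u) (E j u) : ℝ) • E' i u = E' j u := by
    simp [orthonormal_iff_ite.1 (oE u hu)]
  rw [h2] at h1
  rw [h1, ← h0]
  nth_rewrite 1 [← sum_inner_smul_of_orthonormal (oE u₀ hu₀) (E j u)]
  rw [map_sum]
  refine Finset.sum_congr rfl fun i _ => ?_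
  rw [map_smul]
  congr 1
  have := (orthonormalBasisOfFour (oE u₀ hu₀)).equiv_apply_basis
    (orthonormalBasisOfFour (oE' u₀ hu₀)) (Equiv.refl _) i
  simpa [orthonormalBasisOfFour] using this

namespace FlatMinimal

variable {c a b : ℝ} {g g' η η' : Plane → E4} {U : Set Plane}

theorem mono (h : FlatMinimal c g U) {V : Set Plane} (hV : IsOpen V) (hVU : V ⊆ U) :
    FlatMinimal c g V :=
  ⟨hV, h.smooth.mono hVU, fun u hu => h.unit u (hVU hu), fun u hu => h.xx u (hVU hu),
    fun u hu => h.xy u (hVU hu), fun u hu => h.yy u (hVU hu),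
    fun u hu => h.harmonic u (hVU hu)⟩

theorem IsNormalField.mono (h : IsNormalField c g U a b η) {V : Set Plane} (hVU : V ⊆ U) :
    IsNormalField c g V a b η :=
  ⟨h.smooth.mono hVU, fun u hu => h.unit u (hVU hu), fun u hu => h.pos u (hVU hu),
    fun u hu => h.x u (hVU hu), fun u hu => h.y u (hVU hu), fun u hu => h.xx u (hVU hu),
    fun u hu => h.xy u (hVU hu)⟩

theorem IsNormalField.neg (h : IsNormalField c g U a b η) :
    IsNormalField c g U (-a) (-b) (fun u => -η u) :=
  ⟨h.smooth.neg, fun u hu => by simpa using h.unit u hu, fun u hu => by simpa using h.pos u hu,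
    fun u hu => by simpa using h.x u hu, fun u hu => by simpa using h.y u hu,
    fun u hu => by simpa using h.xx u hu, fun u hu => by simpa using h.xy u hu⟩

theorem pos_x (h : FlatMinimal c g U) {u : Plane} (hu : u ∈ U) :
    inner ℝ (g u) (pd 0 g u) = 0 := by
  have := inner_pd_add_inner_pd h.isOpen h.smooth h.smooth h.unit 0 hu
  rw [real_inner_comm] at this; linarith

theorem pos_y (h : FlatMinimal c g U) {u : Plane} (hu : u ∈ U) :
    inner ℝ (g u) (pd 1 g u) = 0 := by
  have := inner_pd_add_inner_pd h.isOpen h.smooth h.smooth h.unit 1 hu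
  rw [real_inner_comm] at this; linarith

theorem inner_xx (h : FlatMinimal c g U) (hη : IsNormalField c g U a b η) {u : Plane}
    (hu : u ∈ U) : inner ℝ (pd 0 (pd 0 g) u) (pd 0 (pd 0 g) u) = c ^ 4 + a ^ 2 := by
  rw [hη.xx u hu]
  simp only [inner_add_left, inner_add_right, inner_smul_left, inner_smul_right, h.unit u hu,
    hη.unit u hu, hη.pos u hu, real_inner_comm (g u) (η u), conj_trivial]
  ring

/-- The orthonormal frame along a flat minimal map. -/
noncomputable def frame (c : ℝ) (g η : Plane → E4) : Fin 4 → Plane → E4 :=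
  ![g, fun u => c⁻¹ • pd 0 g u, pd 1 g, η]

/-- The connection coefficients of the frame, above the diagonal. -/
noncomputable def frameCoeff (c a b : ℝ) (k : Fin 2) : Fin 4 → Fin 4 → ℝ :=
  ![![0, ![c, 0] k, ![0, 1] k, 0], ![0, 0, 0, ![c⁻¹ * a, c⁻¹ * b] k], ![0, 0, 0, ![b, -a] k], 0]

theorem contDiffOn_frame (h : FlatMinimal c g U) (hη : IsNormalField c g U a b η) (i : Fin 4) :
    ContDiffOn ℝ ∞ (frame c g η i) U := by
  fin_cases i
  · exact h.smooth
  · exact (ContDiffOn.pd h.isOpen h.smooth 0).const_smul _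
  · exact ContDiffOn.pd h.isOpen h.smooth 1
  · exact hη.smooth

theorem orthonormal_frame (h : FlatMinimal c g U) (hη : IsNormalField c g U a b η) (hc : c ≠ 0)
    {u : Plane} (hu : u ∈ U) : Orthonormal ℝ fun i => frame c g η i u := by
  rw [orthonormal_iff_ite]
  have h1 := h.pos_x hu
  have h2 := h.pos_y hu
  have h3 := hη.pos u hu
  have h4 := h.xy u hu
  have h5 := hη.x u hu
  have h6 := hη.y u hu
  have h1' := h1; have h2' := h2; have h3' := h3; have h4' := h4; have h5' := h5; have h6' := h6
  rw [real_inner_comm] at h1' h2' h3' h4' h5' h6'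
  have n1 := h.unit u hu
  have n2 : c⁻¹ * (c⁻¹ * inner ℝ (pd 0 g u) (pd 0 g u)) = 1 := by
    rw [h.xx u hu]; field_simp
  have n3 := h.yy u hu
  have n4 := hη.unit u hu
  intro i j
  fin_cases i <;> fin_cases j <;>
    simp only [frame, Fin.zero_eta, Fin.mk_one, Fin.reduceFinMk, Matrix.cons_val, inner_smul_left,
      inner_smul_right, conj_trivial, h1, h2, h3, h4, h5, h6, h1', h2', h3', h4', h5', h6', n1, n2,
      n3, n4, mul_zero] <;> simp

theorem pd_one_one (h : FlatMinimal c g U) (hη : IsNormalField c g U a b η) {u : Plane}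
    (hu : u ∈ U) : pd 1 (pd 1 g) u = -(1 : ℝ) • g u + -a • η u := by
  have := h.harmonic u hu
  rw [hη.xx u hu, eq_comm, ← sub_eq_iff_eq_add'] at this
  rw [← this]; module

theorem inner_pd_frame (h : FlatMinimal c g U) (hη : IsNormalField c g U a b η) (hc : c ≠ 0)
    {u : Plane} (hu : u ∈ U) (k : Fin 2) (i j : Fin 4) (hij : i < j) :
    inner ℝ (pd k (frame c g η i) u) (frame c g η j u) = frameCoeff c a b k i j := by
  have h2 := h.pos_y hu
  have h3 := hη.pos u hu
  have h4 := h.xy u hu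
  have h5 := hη.x u hu
  have h6 := hη.y u hu
  have h4' := h4; have h6' := h6
  rw [real_inner_comm] at h4' h6'
  have n2 : c⁻¹ * inner ℝ (pd 0 g u) (pd 0 g u) = c := by
    rw [h.xx u hu]; field_simp
  have n3 := h.yy u hu
  have n4 := hη.unit u hu
  have d := differentiableAt_of_contDiffOn h.isOpen (ContDiffOn.pd h.isOpen h.smooth 0) hu
  have hyx := pd_comm h.isOpen h.smooth hu 1 0
  fin_cases k <;> fin_cases i <;> fin_cases j <;>
    first
    | exact absurd hij (by decide)
    | (simp only [frame, frameCoeff, Fin.zero_eta, Fin.mk_one, Fin.reduceFinMk, Matrix.cons_val,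
        pd_const_smul d, hyx, hη.xx u hu, hη.xy u hu, h.pd_one_one hη hu, inner_add_left,
        inner_smul_left, inner_smul_right, conj_trivial, h2, h3, h4, h5, h6, h4', h6', n2,
        n3, n4, mul_zero, mul_one, add_zero, zero_add])

/-- The connection coefficients of the frame `(g, g_x / c, g_y, η)` involve only `a`, `b`, `c`, so
these numbers determine the map up to an orthogonal transformation. -/
theorem exists_isometry (h : FlatMinimal c g U) (h' : FlatMinimal c g' U)
    (hη : IsNormalField c g U a b η) (hη' : IsNormalField c g' U a b η') (hc : c ≠ 0)
    (hU : IsPreconnected U) (hne : U.Nonempty) :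
    ∃ L : E4 ≃ₗᵢ[ℝ] E4, ∀ u ∈ U, L (g u) = g' u := by
  obtain ⟨L, hL⟩ := exists_isometry_of_frames h.isOpen hU hne (h.contDiffOn_frame hη)
    (h'.contDiffOn_frame hη') (fun u hu => h.orthonormal_frame hη hc hu)
    (fun u hu => h'.orthonormal_frame hη' hc hu) (fun u hu k i j hij => by
      rw [h.inner_pd_frame hη hc hu k i j hij, h'.inner_pd_frame hη' hc hu k i j hij])
  exact ⟨L, fun u hu => hL u hu 0⟩

end FlatMinimal

/-- The reflection `(x, y) ↦ (x, -y)` of the plane. -/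
noncomputable def reflect : Plane ≃ₗᵢ[ℝ] Plane :=
  LinearIsometryEquiv.piLpCongrRight 2 ![LinearIsometryEquiv.refl ℝ ℝ, LinearIsometryEquiv.neg ℝ]

theorem reflect_apply_zero (u : Plane) : reflect u 0 = u 0 := rfl

theorem reflect_apply_one (u : Plane) : reflect u 1 = -u 1 := rfl

theorem pd_comp_reflect {W : Type*} [NormedAddCommGroup W] [NormedSpace ℝ W] (h : Plane → W) :
    (pd 0 fun u => h (reflect u)) = (fun u => pd 0 h (reflect u)) ∧
    (pd 1 fun u => h (reflect u)) = (fun u => -pd 1 h (reflect u)) := by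
  have e0 : reflect (coordVec 0) = coordVec 0 := by
    ext i; fin_cases i
    · rfl
    · simpa [coordVec] using reflect_apply_one (coordVec 0)
  have e1 : reflect (coordVec 1) = -coordVec 1 := by
    ext i; fin_cases i
    · simpa [coordVec] using reflect_apply_zero (coordVec 1)
    · rfl
  have key : ∀ u, fderiv ℝ (fun u => h (reflect u)) u
      = (fderiv ℝ h (reflect u)).comp (reflect.toContinuousLinearEquiv : Plane →L[ℝ] Plane) :=
    fun u => reflect.toContinuousLinearEquiv.comp_right_fderiv
  constructor
  · funext u; simp [pd, key, e0]
  · funext u; simp [pd, key, e1]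

namespace FlatMinimal

variable {c a b : ℝ} {g g' η η' : Plane → E4} {U : Set Plane}

theorem comp_reflect (h : FlatMinimal c g Set.univ) :
    FlatMinimal c (fun u => g (reflect u)) Set.univ := by
  have hp : ∀ {W : Type} [NormedAddCommGroup W] [NormedSpace ℝ W] (h : Plane → W) u,
      pd 1 (fun u => -h u) u = -pd 1 h u := by
    intro W _ _ h u; simp [pd, fderiv_fun_neg]
  refine ⟨isOpen_univ, ?_, fun u _ => h.unit _ trivial, fun u _ => ?_, fun u _ => ?_,
    fun u _ => ?_, fun u _ => ?_⟩
  · exact (contDiffOn_univ.1 h.smooth).comp_contDiffOn (by fun_prop)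
  · rw [(pd_comp_reflect g).1]; exact h.xx _ trivial
  · rw [(pd_comp_reflect g).1, (pd_comp_reflect g).2]; simpa using h.xy _ trivial
  · rw [(pd_comp_reflect g).2, inner_neg_neg]; exact h.yy _ trivial
  · rw [(pd_comp_reflect g).1, (pd_comp_reflect g).2, (pd_comp_reflect (pd 0 g)).1, hp,
      (pd_comp_reflect (pd 1 g)).2]
    simpa using h.harmonic _ trivial

/-- Among the data only the mixed derivative `g_xy` changes sign under `y ↦ -y`. -/
theorem IsNormalField.comp_reflect (h : IsNormalField c g Set.univ a b η) :
    IsNormalField c (fun u => g (reflect u)) Set.univ a (-b) (fun u => η (reflect u)) := by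
  have hp : ∀ {W : Type} [NormedAddCommGroup W] [NormedSpace ℝ W] (h : Plane → W) u,
      pd 0 (fun u => -h u) u = -pd 0 h u := by
    intro W _ _ h u; simp [pd, fderiv_fun_neg]
  refine ⟨?_, fun u _ => h.unit _ trivial, fun u _ => h.pos _ trivial, fun u _ => ?_,
    fun u _ => ?_, fun u _ => ?_, fun u _ => ?_⟩
  · exact (contDiffOn_univ.1 h.smooth).comp_contDiffOn (by fun_prop)
  · rw [(pd_comp_reflect g).1]; exact h.x _ trivial
  · rw [(pd_comp_reflect g).2]; simpa using h.y _ trivial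
  · rw [(pd_comp_reflect g).1, (pd_comp_reflect (pd 0 g)).1]; exact h.xx _ trivial
  · rw [(pd_comp_reflect g).2, hp, (pd_comp_reflect (pd 1 g)).1]
    simpa using h.xy _ trivial

/-- The quantity is `c⁴ + a²`, and `a² + b² = c²`. These bounds delimit the range that the explicit
family has to cover. -/
theorem sq_add_sq (h : FlatMinimal c g U) (hc : c ≠ 0) (hU : IsPreconnected U) {u : Plane}
    (hu : u ∈ U) : c ^ 4 ≤ inner ℝ (pd 0 (pd 0 g) u) (pd 0 (pd 0 g) u) ∧
      inner ℝ (pd 0 (pd 0 g) u) (pd 0 (pd 0 g) u) ≤ c ^ 4 + c ^ 2 := by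
  obtain ⟨a, b, η, hab, hη⟩ := h.exists_normalField hc hU ⟨u, hu⟩
  rw [h.inner_xx hη hu]
  constructor <;> nlinarith [sq_nonneg a, sq_nonneg b]

/-- Two flat minimal maps with the same length of `∂²g/∂x²` are congruent, up to a reflection. -/
theorem exists_isometry_or_reflect (h : FlatMinimal c g U) (h' : FlatMinimal c g' Set.univ)
    (hc : c ≠ 0) (hU : IsPreconnected U) {u v : Plane} (hu : u ∈ U)
    (huv : (inner ℝ (pd 0 (pd 0 g) u) (pd 0 (pd 0 g) u) : ℝ)
      = inner ℝ (pd 0 (pd 0 g') v) (pd 0 (pd 0 g') v)) :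
    ∃ L : E4 ≃ₗᵢ[ℝ] E4, (∀ u ∈ U, L (g u) = g' u) ∨ (∀ u ∈ U, L (g u) = g' (reflect u)) := by
  obtain ⟨a, b, η, hab, hη⟩ := h.exists_normalField hc hU ⟨u, hu⟩
  obtain ⟨a', b', η', hab', hη'⟩ := h'.exists_normalField hc isPreconnected_univ ⟨v, trivial⟩
  rw [h.inner_xx hη hu, h'.inner_xx hη' trivial] at huv
  -- Equal lengths give `a = ±a'`; the sign is absorbed by the choice of normal of `g'`. The
  -- remaining sign, that of `b`, is absorbed by the reflection.
  obtain ⟨b'', η'', hab'', hη''⟩ : ∃ b'' η'', a ^ 2 + b'' ^ 2 = c ^ 2 ∧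
      IsNormalField c g' Set.univ a b'' η'' := by
    rcases sq_eq_sq_iff_eq_or_eq_neg.1 (by linarith : a ^ 2 = a' ^ 2) with h | h
    · subst h; exact ⟨b', η', hab', hη'⟩
    · subst h; exact ⟨-b', _, by simpa using hab', hη'.neg⟩
  rcases sq_eq_sq_iff_eq_or_eq_neg.1 (by linarith : b ^ 2 = b'' ^ 2) with e | e
  · subst e
    obtain ⟨L, hL⟩ := h.exists_isometry (h'.mono h.isOpen (Set.subset_univ _)) hη
      (hη''.mono (Set.subset_univ _)) hc hU ⟨u, hu⟩
    exact ⟨L, Or.inl hL⟩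
  · subst e
    obtain ⟨L, hL⟩ := h.exists_isometry (h'.comp_reflect.mono h.isOpen (Set.subset_univ _)) hη
      (hη''.comp_reflect.mono (Set.subset_univ _)) hc hU ⟨u, hu⟩
    exact ⟨L, Or.inr hL⟩

end FlatMinimal

end S3R

/-! ### Isometries of `𝕊³ × ℝ` -/

namespace S3R

/-- The point of `𝔼⁵ = 𝔼⁴ × ℝ` with given components. -/
noncomputable def pair (g : E4) (t : ℝ) : E5 :=
  WithLp.toLp 2 (Fin.snoc (α := fun _ => ℝ) (fun i => g i) t)

@[simp] theorem horiz_apply (x : E5) (i : Fin 4) : horiz x i = x i.castSucc := rfl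

@[simp] theorem horiz_pair (g : E4) (t : ℝ) : horiz (pair g t) = g := by
  ext i; simp [pair]

@[simp] theorem pair_apply_four (g : E4) (t : ℝ) : pair g t 4 = t :=
  Fin.snoc_last (n := 4) (α := fun _ => ℝ) t (fun i => g i)

theorem ext_horiz {x y : E5} (h : horiz x = horiz y) (h4 : x 4 = y 4) : x = y := by
  ext i
  refine Fin.lastCases h4 (fun j => ?_) i
  rw [← horiz_apply, ← horiz_apply, h]

theorem inner_eq_horiz (x y : E5) :
    (inner ℝ x y : ℝ) = inner ℝ (horiz x) (horiz y) + x 4 * y 4 := by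
  simp only [PiLp.inner_apply, Fin.sum_univ_castSucc (n := 4), horiz_apply]
  congr 1
  exact mul_comm _ _

theorem geoDist_sq (x y : S3xR) : geoDist x y ^ 2 =
    InnerProductGeometry.angle (horiz x) (horiz y) ^ 2 + ((x : E5) 4 - (y : E5) 4) ^ 2 :=
  Real.sq_sqrt (by positivity)

/-- The point of `𝕊³ × ℝ` with given components. -/
noncomputable def point (p : E4) (hp : ‖p‖ = 1) (t : ℝ) : S3xR :=
  ⟨pair p t, by rw [S3xR, Set.mem_ofPred_eq, horiz_pair, hp]⟩

@[simp] theorem horiz_point (p : E4) (hp : ‖p‖ = 1) (t : ℝ) : horiz (point p hp t) = p :=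
  horiz_pair p t

@[simp] theorem point_apply_four (p : E4) (hp : ‖p‖ = 1) (t : ℝ) :
    (point p hp t : E5) 4 = t :=
  pair_apply_four p t

theorem point_eta (x : S3xR) : point (horiz x) x.2 ((x : E5) 4) = x :=
  Subtype.ext (ext_horiz (horiz_point _ x.2 _) (point_apply_four _ x.2 _))

theorem eq_of_angle_eq_zero {p q : E4} (hp : ‖p‖ = 1) (hq : ‖q‖ = 1)
    (h : InnerProductGeometry.angle p q = 0) : p = q := by
  have := InnerProductGeometry.inner_eq_mul_norm_of_angle_eq_zero h
  rw [hp, hq] at this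
  exact (inner_eq_one_iff_of_norm_eq_one (𝕜 := ℝ) hp hq).1 (by rw [this]; norm_num)

theorem inner_eq_cos_angle {p q : E4} (hp : ‖p‖ = 1) (hq : ‖q‖ = 1) :
    inner ℝ p q = Real.cos (InnerProductGeometry.angle p q) := by
  rw [InnerProductGeometry.cos_angle, hp, hq]; simp

namespace Isom

theorem angle_sq_add (Φ : Isom) (x y : S3xR) :
    InnerProductGeometry.angle (horiz (Φ.toEquiv x)) (horiz (Φ.toEquiv y)) ^ 2
      + ((Φ.toEquiv x : E5) 4 - (Φ.toEquiv y : E5) 4) ^ 2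
    = InnerProductGeometry.angle (horiz x) (horiz y) ^ 2 + ((x : E5) 4 - (y : E5) 4) ^ 2 := by
  rw [← geoDist_sq, ← geoDist_sq, Φ.geoDist_map]

theorem angle_sq_le (p q : E4) : InnerProductGeometry.angle p q ^ 2 ≤ Real.pi ^ 2 :=
  pow_le_pow_left₀ (InnerProductGeometry.angle_nonneg p q)
    (InnerProductGeometry.angle_le_pi p q) 2

/-- An isometry of `𝕊³ × ℝ` does not shorten the height of vertical segments. -/
theorem le_abs_height_sub (Φ : Isom) (p : E4) (hp : ‖p‖ = 1) {A B : ℝ} (hAB : A ≤ B) :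
    B - A ≤ |(Φ.toEquiv (point p hp A) : E5) 4 - (Φ.toEquiv (point p hp B) : E5) 4| := by
  by_contra! hlt
  set h : ℝ → ℝ := fun t => (Φ.toEquiv (point p hp t) : E5) 4 with hh
  have e : ∀ s t, InnerProductGeometry.angle (horiz (Φ.toEquiv (point p hp s)))
      (horiz (Φ.toEquiv (point p hp t))) ^ 2 + (h s - h t) ^ 2 = (s - t) ^ 2 := fun s t => by
    have := Φ.angle_sq_add (point p hp s) (point p hp t)
    simpa [InnerProductGeometry.angle_self (show p ≠ 0 by rintro rfl; simp at hp)] using this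
  set d := |h A - h B| with hd
  set δ := B - A - d with hδ
  have hδ0 : 0 < δ := by simp only [hδ]; linarith
  -- If the height falls short by `δ` between `A` and `B`, it falls short by at least `δ` between
  -- `A` and any later `C`. The missing distance must come from the sphere, which supplies at most
  -- `π`. This is impossible once `δ (C - A)` exceeds `(π² + δ²) / 2`, as it does for this `C`.
  set C : ℝ := B + δ + Real.pi ^ 2 / δ with hC
  have hpi : 0 < Real.pi ^ 2 / δ := by positivity
  have hCB : |h B - h C| ≤ C - B := by
    refine abs_le_of_sq_le_sq ?_ (by linarith)
    have := e B C
    nlinarith [sq_nonneg (InnerProductGeometry.angle (horiz (Φ.toEquiv (point p hp B)))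
      (horiz (Φ.toEquiv (point p hp C))))]
  have hCA : (C - A) ^ 2 - Real.pi ^ 2 ≤ (h A - h C) ^ 2 := by
    have := e A C
    have := angle_sq_le (horiz (Φ.toEquiv (point p hp A))) (horiz (Φ.toEquiv (point p hp C)))
    nlinarith
  have hle : |h A - h C| ≤ C - A - δ := by
    have := abs_sub_le (h A) (h B) (h C)
    linarith
  have hsq : (h A - h C) ^ 2 ≤ (C - A - δ) ^ 2 := by
    rw [← sq_abs]; exact pow_le_pow_left₀ (abs_nonneg _) hle 2
  have hδπ : δ * (Real.pi ^ 2 / δ) = Real.pi ^ 2 := by field_simp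
  have : δ * (C - A) ≥ δ * (δ + Real.pi ^ 2 / δ) := by
    apply mul_le_mul_of_nonneg_left _ hδ0.le
    linarith
  nlinarith [Real.pi_pos]

/-- The height difference already uses up the whole distance, so nothing is left for the angle:
vertical lines go to vertical lines. -/
theorem height_sub_sq (Φ : Isom) (p : E4) (hp : ‖p‖ = 1) (s t : ℝ) :
    ((Φ.toEquiv (point p hp s) : E5) 4 - (Φ.toEquiv (point p hp t) : E5) 4) ^ 2 = (s - t) ^ 2 ∧
    horiz (Φ.toEquiv (point p hp s)) = horiz (Φ.toEquiv (point p hp t)) := by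
  have h1 : |s - t| ≤
      |(Φ.toEquiv (point p hp s) : E5) 4 - (Φ.toEquiv (point p hp t) : E5) 4| := by
    rcases le_total s t with h | h
    · rw [abs_sub_comm s t, abs_of_nonneg (sub_nonneg.2 h)]
      exact Φ.le_abs_height_sub p hp h
    · rw [abs_of_nonneg (sub_nonneg.2 h), abs_sub_comm ((Φ.toEquiv (point p hp s) : E5) 4)]
      exact Φ.le_abs_height_sub p hp h
  have h2 := sq_le_sq.2 h1
  have h3 := Φ.angle_sq_add (point p hp s) (point p hp t)
  simp only [horiz_point, point_apply_four,
    InnerProductGeometry.angle_self (show p ≠ 0 by rintro rfl; simp at hp)] at h3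
  have h4 := sq_nonneg (InnerProductGeometry.angle (horiz (Φ.toEquiv (point p hp s)))
    (horiz (Φ.toEquiv (point p hp t))))
  refine ⟨by linarith, eq_of_angle_eq_zero (Φ.toEquiv _).2 (Φ.toEquiv _).2 ?_⟩
  exact pow_eq_zero_iff (two_ne_zero) |>.1 (by linarith)

/-- An isometry of `𝕊³ × ℝ` is the product of an orthogonal map and an isometry of the line. -/
theorem exists_eq (Φ : Isom) : ∃ (L : E4 ≃ₗᵢ[ℝ] E4) (ε τ : ℝ), ε ^ 2 = 1 ∧
    ∀ x : S3xR, horiz (Φ.toEquiv x) = L (horiz x) ∧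
      (Φ.toEquiv x : E5) 4 = ε * (x : E5) 4 + τ := by
  set h : ∀ (p : E4), ‖p‖ = 1 → ℝ → ℝ := fun p hp t => (Φ.toEquiv (point p hp t) : E5) 4 with hh
  set α : ∀ (p : E4), ‖p‖ = 1 → E4 := fun p hp => horiz (Φ.toEquiv (point p hp 0)) with hα
  have hαn : ∀ p hp, ‖α p hp‖ = 1 := fun p hp => (Φ.toEquiv (point p hp 0)).2
  have hαt : ∀ p hp t, horiz (Φ.toEquiv (point p hp t)) = α p hp := fun p hp t =>
    (Φ.height_sub_sq p hp t 0).2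
  have hsq : ∀ p hp s t, (h p hp s - h p hp t) ^ 2 = (s - t) ^ 2 := fun p hp s t =>
    (Φ.height_sub_sq p hp s t).1
  have hε : ∀ p hp, (h p hp 1 - h p hp 0) ^ 2 = 1 := fun p hp => by rw [hsq]; norm_num
  have hlin : ∀ p hp t, h p hp t = (h p hp 1 - h p hp 0) * t + h p hp 0 := fun p hp t => by
    have h1 := hsq p hp t 0
    have h2 := hsq p hp t 1
    have h3 := hε p hp
    have h4 : (h p hp t - h p hp 0) * (h p hp 1 - h p hp 0) = t := by linarith
    linear_combination (h p hp 1 - h p hp 0) * h4 - (h p hp t - h p hp 0) * h3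
  have hdist : ∀ p hp q hq s t, InnerProductGeometry.angle (α p hp) (α q hq) ^ 2
      + (h p hp s - h q hq t) ^ 2 = InnerProductGeometry.angle p q ^ 2 + (s - t) ^ 2 :=
    fun p hp q hq s t => by
      have := Φ.angle_sq_add (point p hp s) (point q hq t)
      rwa [hαt, hαt, horiz_point, horiz_point, point_apply_four, point_apply_four] at this
  -- Two vertical lines keep bounded distance at equal heights. With different slopes their images
  -- would at some `t` have height difference `π + 1`, more than the distance `angle p q ≤ π`
  -- allows.
  have hεc : ∀ p hp q hq, h p hp 1 - h p hp 0 = h q hq 1 - h q hq 0 := fun p hp q hq => by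
    by_contra hne
    have hne' := sub_ne_zero.2 hne
    set D := (h p hp 1 - h p hp 0) - (h q hq 1 - h q hq 0)
    set t := (Real.pi + 1 - (h p hp 0 - h q hq 0)) / D with ht
    have h1 := hdist p hp q hq t t
    have h2 : h p hp t - h q hq t = Real.pi + 1 := by
      have : D * t = Real.pi + 1 - (h p hp 0 - h q hq 0) := by rw [ht]; field_simp
      rw [hlin p hp t, hlin q hq t]; simp only [D] at this; linarith
    rw [h2] at h1
    have := angle_sq_le p q
    nlinarith [sq_nonneg (InnerProductGeometry.angle (α p hp) (α q hq)), Real.pi_pos]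
  -- The points at heights `1` and `-1` over `p` are equally far from height `0` over `q`. Comparing
  -- their images kills the offset between the two lines.
  have hτc : ∀ p hp q hq, h p hp 0 = h q hq 0 := fun p hp q hq => by
    have h1 := hdist p hp q hq 1 0
    have h2 := hdist p hp q hq (-1) 0
    rw [hlin p hp (-1)] at h2
    have h3 := hε p hp
    have h4 : (h p hp 1 - h p hp 0) * (h p hp 0 - h q hq 0) = 0 := by nlinarith
    rcases mul_eq_zero.1 h4 with h5 | h5
    · rw [h5] at h3; norm_num at h3
    · linarith
  have hang : ∀ p hp q hq, (inner ℝ (α p hp) (α q hq) : ℝ) = inner ℝ p q := fun p hp q hq => by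
    have h1 := hdist p hp q hq 0 0
    rw [hτc p hp q hq, sub_self, sub_self] at h1
    have h2 : InnerProductGeometry.angle (α p hp) (α q hq) = InnerProductGeometry.angle p q := by
      rwa [add_left_inj, sq_eq_sq₀ (InnerProductGeometry.angle_nonneg _ _)
        (InnerProductGeometry.angle_nonneg _ _)] at h1
    rw [inner_eq_cos_angle (hαn p hp) (hαn q hq), h2, inner_eq_cos_angle hp hq]
  have hen : ∀ i : Fin 4, ‖(EuclideanSpace.basisFun (Fin 4) ℝ i : E4)‖ = 1 := fun i =>
    (EuclideanSpace.basisFun (Fin 4) ℝ).orthonormal.1 i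
  set e := EuclideanSpace.basisFun (Fin 4) ℝ with he
  -- A map of the sphere preserving inner products is the restriction of the linear map given by the
  -- images of the basis vectors, since inner products with these determine every image.
  have ho : Orthonormal ℝ fun i => α (e i) (hen i) := by
    rw [orthonormal_iff_ite]
    intro i j
    rw [hang]
    exact orthonormal_iff_ite.1 e.orthonormal i j
  have hL : ∀ p hp, α p hp = e.equiv (orthonormalBasisOfFour ho) (Equiv.refl _) p := by
    intro p hp
    rw [← sum_inner_smul_of_orthonormal ho (α p hp)]
    conv_rhs => rw [← e.sum_repr' p]
    rw [map_sum]
    refine Finset.sum_congr rfl fun i _ => ?_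
    rw [map_smul, hang, e.equiv_apply_basis]
    simp [orthonormalBasisOfFour]
  refine ⟨e.equiv (orthonormalBasisOfFour ho) (Equiv.refl _), h (e 0) (hen 0) 1 - h (e 0) (hen 0) 0,
    h (e 0) (hen 0) 0, hε _ _, fun x => ⟨?_, ?_⟩⟩
  · rw [← hL _ x.2, ← hαt _ x.2 ((x : E5) 4), point_eta]
  · have := hlin _ x.2 ((x : E5) 4)
    rw [hεc _ x.2 (e 0) (hen 0), hτc _ x.2 (e 0) (hen 0)] at this
    rw [← this]
    simp only [h, point_eta]

/-- The isometry of `𝕊³ × ℝ` induced by an orthogonal map of `𝔼⁴`. -/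
noncomputable def ofLinearIsometry (L : E4 ≃ₗᵢ[ℝ] E4) : Isom where
  toEquiv :=
    { toFun := fun x => point (L (horiz x)) (by rw [L.norm_map]; exact x.2) ((x : E5) 4)
      invFun := fun x => point (L.symm (horiz x)) (by rw [L.symm.norm_map]; exact x.2) ((x : E5) 4)
      left_inv := fun x => Subtype.ext (ext_horiz (by simp) (by simp))
      right_inv := fun x => Subtype.ext (ext_horiz (by simp) (by simp)) }
  geoDist_map := fun x y => by
    simp [geoDist, InnerProductGeometry.angle]

theorem horiz_ofLinearIsometry (L : E4 ≃ₗᵢ[ℝ] E4) (x : S3xR) :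
    horiz ((ofLinearIsometry L).toEquiv x) = L (horiz x) :=
  horiz_point _ (by rw [L.norm_map]; exact x.2) _

theorem ofLinearIsometry_apply_four (L : E4 ≃ₗᵢ[ℝ] E4) (x : S3xR) :
    ((ofLinearIsometry L).toEquiv x : E5) 4 = (x : E5) 4 :=
  point_apply_four _ (by rw [L.norm_map]; exact x.2) _

end Isom

end S3R

/-! ### The explicit maps: tori in the sphere and their parameters -/

namespace S3R

/-- The linear form `(x, y) ↦ kx + ly`. -/
noncomputable def phase (k l : ℝ) : Plane →L[ℝ] ℝ :=
  k • EuclideanSpace.proj 0 + l • EuclideanSpace.proj 1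

theorem phase_apply (k l : ℝ) (u : Plane) : phase k l u = k * u 0 + l * u 1 := by
  simp [phase]

theorem phase_coordVec (k l : ℝ) (i : Fin 2) : phase k l (coordVec i) = ![k, l] i := by
  fin_cases i <;> simp [phase, coordVec]

/-- A doubly periodic map to the product of two circles of radii `a` and `b`. -/
noncomputable def torus (φ χ : Plane →L[ℝ] ℝ) (a b : ℝ) (u : Plane) : E4 :=
  !₂[a * Real.cos (φ u), a * Real.sin (φ u), b * Real.cos (χ u), b * Real.sin (χ u)]

/-- The map `torus`, turned by a right angle in both circles. -/
noncomputable def torusTurn (φ χ : Plane →L[ℝ] ℝ) (a b : ℝ) (u : Plane) : E4 :=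
  !₂[-a * Real.sin (φ u), a * Real.cos (φ u), -b * Real.sin (χ u), b * Real.cos (χ u)]

variable (φ χ : Plane →L[ℝ] ℝ) (a b a' b' : ℝ)

theorem contDiff_torus {n : WithTop ℕ∞} : ContDiff ℝ n (torus φ χ a b) := by
  rw [contDiff_euclidean]
  intro i
  fin_cases i <;> simp [torus] <;> fun_prop

theorem contDiff_torusTurn {n : WithTop ℕ∞} : ContDiff ℝ n (torusTurn φ χ a b) := by
  rw [contDiff_euclidean]
  intro i
  fin_cases i <;> simp [torusTurn] <;> fun_prop

theorem pd_apply {n : ℕ} {h : Plane → EuclideanSpace ℝ (Fin n)} {u : Plane}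
    (hh : DifferentiableAt ℝ h u) (i : Fin 2) (j : Fin n) :
    pd i h u j = pd i (fun u => h u j) u := by
  have : HasFDerivAt (fun u => h u j)
      ((EuclideanSpace.proj j : EuclideanSpace ℝ (Fin n) →L[ℝ] ℝ).comp (fderiv ℝ h u)) u :=
    (EuclideanSpace.proj j : EuclideanSpace ℝ (Fin n) →L[ℝ] ℝ).hasFDerivAt.comp u hh.hasFDerivAt
  rw [pd, pd, this.fderiv]
  rfl

theorem pd_mul_cos (i : Fin 2) (u : Plane) :
    pd i (fun u => a * Real.cos (φ u)) u = -(a * φ (coordVec i)) * Real.sin (φ u) := by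
  rw [pd, ((φ.hasFDerivAt (x := u)).cos.const_mul a).fderiv]
  simp; ring

theorem pd_mul_sin (i : Fin 2) (u : Plane) :
    pd i (fun u => a * Real.sin (φ u)) u = a * φ (coordVec i) * Real.cos (φ u) := by
  rw [pd, ((φ.hasFDerivAt (x := u)).sin.const_mul a).fderiv]
  simp; ring

theorem pd_torus (i : Fin 2) : pd i (torus φ χ a b) =
    torusTurn φ χ (a * φ (coordVec i)) (b * χ (coordVec i)) := by
  funext u
  ext j
  rw [pd_apply ((contDiff_torus φ χ a b).differentiable one_ne_zero u)]
  fin_cases j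
  · exact pd_mul_cos φ a i u
  · exact pd_mul_sin φ a i u
  · exact pd_mul_cos χ b i u
  · exact pd_mul_sin χ b i u

theorem pd_torusTurn (i : Fin 2) : pd i (torusTurn φ χ a b) =
    torus φ χ (-a * φ (coordVec i)) (-b * χ (coordVec i)) := by
  funext u
  ext j
  rw [pd_apply ((contDiff_torusTurn φ χ a b).differentiable one_ne_zero u)]
  fin_cases j
  · exact pd_mul_sin φ (-a) i u
  · exact (pd_mul_cos φ a i u).trans (by simp [torus])
  · exact pd_mul_sin χ (-b) i u
  · exact (pd_mul_cos χ b i u).trans (by simp [torus])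

theorem inner_torus (u : Plane) :
    inner ℝ (torus φ χ a b u) (torus φ χ a' b' u) = a * a' + b * b' := by
  simp only [torus, PiLp.inner_apply, Fin.sum_univ_four, RCLike.inner_apply, conj_trivial,
    Matrix.cons_val]
  linear_combination a * a' * Real.sin_sq_add_cos_sq (φ u) + b * b' * Real.sin_sq_add_cos_sq (χ u)

theorem inner_torusTurn (u : Plane) :
    inner ℝ (torusTurn φ χ a b u) (torusTurn φ χ a' b' u) = a * a' + b * b' := by
  simp only [torusTurn, PiLp.inner_apply, Fin.sum_univ_four, RCLike.inner_apply, conj_trivial,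
    Matrix.cons_val]
  linear_combination a * a' * Real.sin_sq_add_cos_sq (φ u) + b * b' * Real.sin_sq_add_cos_sq (χ u)

theorem torus_add (u : Plane) :
    torus φ χ a b u + torus φ χ a' b' u = torus φ χ (a + a') (b + b') u := by
  ext j; fin_cases j <;> simp [torus] <;> ring

theorem smul_torus (r : ℝ) (u : Plane) : r • torus φ χ a b u = torus φ χ (r * a) (r * b) u := by
  ext j; fin_cases j <;> simp [torus] <;> ring

/-- Each circle component is an eigenfunction of the flat Laplacian, with eigenvalue minus the
squared length of its frequency vector. Hence `h1` and `h2` give harmonicity, and the other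
hypotheses give the metric. -/
theorem flatMinimal_torus {a b c k l k' l' : ℝ} (h0 : a ^ 2 + b ^ 2 = 1)
    (hxx : a ^ 2 * k ^ 2 + b ^ 2 * k' ^ 2 = c ^ 2) (hxy : a ^ 2 * (k * l) + b ^ 2 * (k' * l') = 0)
    (hyy : a ^ 2 * l ^ 2 + b ^ 2 * l' ^ 2 = 1) (h1 : k ^ 2 + l ^ 2 = 1 + c ^ 2)
    (h2 : k' ^ 2 + l' ^ 2 = 1 + c ^ 2) :
    FlatMinimal c (torus (phase k l) (phase k' l') a b) Set.univ := by
  refine ⟨isOpen_univ, (contDiff_torus _ _ _ _).contDiffOn, fun u _ => ?_, fun u _ => ?_,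
    fun u _ => ?_, fun u _ => ?_, fun u _ => ?_⟩ <;>
  simp only [pd_torus, pd_torusTurn, inner_torus, inner_torusTurn, torus_add, smul_torus,
    phase_coordVec, Matrix.cons_val]
  · linear_combination h0
  · linear_combination hxx
  · linear_combination hxy
  · linear_combination hyy
  · congr 1
    · linear_combination -a * h1
    · linear_combination -b * h2

theorem inner_pd_pd_torus {a b k l k' l' : ℝ} (u : Plane) :
    inner ℝ (pd 0 (pd 0 (torus (phase k l) (phase k' l') a b)) u)
      (pd 0 (pd 0 (torus (phase k l) (phase k' l') a b)) u)
    = a ^ 2 * (k ^ 2) ^ 2 + b ^ 2 * (k' ^ 2) ^ 2 := by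
  simp only [pd_torus, pd_torusTurn, inner_torus, phase_coordVec, Matrix.cons_val]
  ring

/-- The first factor of the explicit map `model`. -/
noncomputable def modelS3 (θ ν : ℝ) (u : Plane) : E4 := horiz (model θ ν (u 0) (u 1))

theorem modelS3_eq (θ ν : ℝ) : modelS3 θ ν =
    torus (phase (mu1 θ ν) (nu2 θ ν)) (phase (mu2 θ ν) (-ν)) (c1 θ ν) (c2 θ ν) := by
  funext u
  ext j
  fin_cases j <;> simp [modelS3, model, torus, phase_apply, horiz, sub_eq_add_neg]

theorem model_apply_four (θ ν x y : ℝ) : model θ ν x y 4 = x * Real.sin θ := by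
  simp [model]

theorem model_eq (θ ν : ℝ) (u : Plane) :
    model θ ν (u 0) (u 1) = pair (modelS3 θ ν u) (u 0 * Real.sin θ) :=
  ext_horiz (by simp [modelS3]) (by simp [model_apply_four])

section Parameters

variable {θ ν : ℝ}

/-- At the largest `ν` the first quantity equals `1 - (1 + c²)(1 - c²) = c⁴`, with `c = cos θ`. -/
theorem one_sub_pos (hθ : 0 < Real.cos θ) (hν : ν ∈ Set.Icc 1 (√(1 + Real.cos θ ^ 2))) :
    0 < 1 - ν ^ 2 * Real.sin θ ^ 2 ∧ 0 ≤ 1 + Real.cos θ ^ 2 - ν ^ 2 := by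
  have h1 : ν ^ 2 ≤ 1 + Real.cos θ ^ 2 := by
    rw [← Real.sq_sqrt (show 0 ≤ 1 + Real.cos θ ^ 2 by positivity)]
    exact pow_le_pow_left₀ (by linarith [hν.1]) hν.2 2
  have h2 := Real.sin_sq_add_cos_sq θ
  have h3 : 0 < Real.cos θ ^ 2 * Real.cos θ ^ 2 := by positivity
  refine ⟨?_, by linarith⟩
  nlinarith [sq_nonneg (Real.sin θ)]

theorem c1_sq (hθ : 0 < Real.cos θ) (hν : ν ∈ Set.Icc 1 (√(1 + Real.cos θ ^ 2))) :
    c1 θ ν ^ 2 = (1 - ν ^ 2 * Real.sin θ ^ 2) / (1 + Real.cos θ ^ 2 - ν ^ 2 * Real.sin θ ^ 2) := by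
  have := (one_sub_pos hθ hν).1
  have : 0 < Real.cos θ ^ 2 := by positivity
  exact Real.sq_sqrt (div_nonneg (by linarith) (by linarith))

theorem c2_sq (hθ : 0 < Real.cos θ) (hν : ν ∈ Set.Icc 1 (√(1 + Real.cos θ ^ 2))) :
    c2 θ ν ^ 2 = Real.cos θ ^ 2 / (1 + Real.cos θ ^ 2 - ν ^ 2 * Real.sin θ ^ 2) := by
  have := (one_sub_pos hθ hν).1
  have : 0 < Real.cos θ ^ 2 := by positivity
  exact Real.sq_sqrt (div_nonneg (by linarith) (by linarith))

theorem mu1_sq (hθ : 0 < Real.cos θ) (hν : ν ∈ Set.Icc 1 (√(1 + Real.cos θ ^ 2))) :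
    mu1 θ ν ^ 2 = ν ^ 2 * Real.cos θ ^ 4 / (1 - ν ^ 2 * Real.sin θ ^ 2) :=
  Real.sq_sqrt (div_nonneg (by positivity) (one_sub_pos hθ hν).1.le)

theorem mu2_sq (hθ : 0 < Real.cos θ) (hν : ν ∈ Set.Icc 1 (√(1 + Real.cos θ ^ 2))) :
    mu2 θ ν ^ 2 = 1 + Real.cos θ ^ 2 - ν ^ 2 :=
  Real.sq_sqrt (one_sub_pos hθ hν).2

theorem nu2_sq (hθ : 0 < Real.cos θ) (hν : ν ∈ Set.Icc 1 (√(1 + Real.cos θ ^ 2))) :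
    nu2 θ ν ^ 2 = (1 + Real.cos θ ^ 2 - ν ^ 2) / (1 - ν ^ 2 * Real.sin θ ^ 2) :=
  Real.sq_sqrt (div_nonneg (one_sub_pos hθ hν).2 (one_sub_pos hθ hν).1.le)

/-- Orthogonality of `g_x` and `g_y` involves products of the frequencies rather than their squares.
The nonnegativity of all the roots fixes the sign. -/
theorem mu1_mul_nu2 (hθ : 0 < Real.cos θ) (hν : ν ∈ Set.Icc 1 (√(1 + Real.cos θ ^ 2))) :
    mu1 θ ν * nu2 θ ν = ν * Real.cos θ ^ 2 * mu2 θ ν / (1 - ν ^ 2 * Real.sin θ ^ 2) := by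
  have h := (one_sub_pos hθ hν).1
  have hν0 : 0 ≤ ν := by linarith [hν.1]
  have hl : 0 ≤ mu1 θ ν * nu2 θ ν := mul_nonneg (Real.sqrt_nonneg _) (Real.sqrt_nonneg _)
  have hr : 0 ≤ ν * Real.cos θ ^ 2 * mu2 θ ν / (1 - ν ^ 2 * Real.sin θ ^ 2) :=
    div_nonneg (mul_nonneg (by positivity) (Real.sqrt_nonneg _)) h.le
  rw [← sq_eq_sq₀ hl hr, mul_pow, div_pow, mul_pow,
    mu1_sq hθ hν, nu2_sq hθ hν, mu2_sq hθ hν]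
  have := h.ne'
  field_simp

theorem flatMinimal_modelS3 (hθ : 0 < Real.cos θ)
    (hν : ν ∈ Set.Icc 1 (√(1 + Real.cos θ ^ 2))) :
    FlatMinimal (Real.cos θ) (modelS3 θ ν) Set.univ := by
  obtain ⟨h1, h2⟩ := one_sub_pos hθ hν
  have h3 : 1 + Real.cos θ ^ 2 - ν ^ 2 * Real.sin θ ^ 2 ≠ 0 := by nlinarith
  have h1' := h1.ne'
  rw [modelS3_eq]
  have hs : Real.sin θ ^ 2 = 1 - Real.cos θ ^ 2 := Real.sin_sq θ
  have e1 := c1_sq hθ hν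
  have e2 := c2_sq hθ hν
  have e3 := mu1_sq hθ hν
  have e4 := mu2_sq hθ hν
  have e5 := nu2_sq hθ hν
  have e6 := mu1_mul_nu2 hθ hν
  rw [hs] at h3 h1' e1 e2 e3 e5 e6
  apply flatMinimal_torus
  · rw [e1, e2]; field_simp; ring
  · rw [e1, e2, e3, e4]; field_simp; ring
  · rw [e1, e2, e6]; field_simp; ring
  · rw [e1, e2, e5, neg_sq]; field_simp; ring
  · rw [e3, e5]; field_simp; ring
  · rw [e4]; ring

/-- Intermediate value theorem for `|g_xx|²` as a function of `ν`. The endpoint `ν = 1` is the case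
`a = 0`, and the endpoint `ν = √(1 + cos² θ)` is the case `b = 0`. -/
theorem exists_parameter (hθ : 0 < Real.cos θ) {r : ℝ} (h1 : Real.cos θ ^ 4 ≤ r)
    (h2 : r ≤ Real.cos θ ^ 4 + Real.cos θ ^ 2) :
    ∃ ν ∈ Set.Icc 1 (√(1 + Real.cos θ ^ 2)), ∀ u,
      inner ℝ (pd 0 (pd 0 (modelS3 θ ν)) u) (pd 0 (pd 0 (modelS3 θ ν)) u) = r := by
  have hc : 0 < Real.cos θ ^ 2 := by positivity
  have hs : Real.sin θ ^ 2 = 1 - Real.cos θ ^ 2 := Real.sin_sq θ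
  have hle : 1 ≤ √(1 + Real.cos θ ^ 2) := Real.one_le_sqrt.2 (by linarith)
  set ψ : ℝ → ℝ := fun ν =>
    (1 - ν ^ 2 * Real.sin θ ^ 2) / (1 + Real.cos θ ^ 2 - ν ^ 2 * Real.sin θ ^ 2) *
      (ν ^ 2 * Real.cos θ ^ 4 / (1 - ν ^ 2 * Real.sin θ ^ 2)) ^ 2
    + Real.cos θ ^ 2 / (1 + Real.cos θ ^ 2 - ν ^ 2 * Real.sin θ ^ 2) *
      (1 + Real.cos θ ^ 2 - ν ^ 2) ^ 2 with hψ
  have hcont : ContinuousOn ψ (Set.Icc 1 (√(1 + Real.cos θ ^ 2))) := by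
    have d1 : ∀ ν ∈ Set.Icc 1 (√(1 + Real.cos θ ^ 2)), 1 - ν ^ 2 * Real.sin θ ^ 2 ≠ 0 :=
      fun ν hν => (one_sub_pos hθ hν).1.ne'
    have d2 : ∀ ν ∈ Set.Icc 1 (√(1 + Real.cos θ ^ 2)),
        1 + Real.cos θ ^ 2 - ν ^ 2 * Real.sin θ ^ 2 ≠ 0 :=
      fun ν hν => by have := (one_sub_pos hθ hν).1; linarith
    refine ContinuousOn.add (ContinuousOn.mul (ContinuousOn.div ?_ ?_ d2)
      (ContinuousOn.pow (ContinuousOn.div ?_ ?_ d1) 2))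
      (ContinuousOn.mul (ContinuousOn.div ?_ ?_ d2) ?_) <;> fun_prop
  have e1 : ψ 1 = Real.cos θ ^ 4 := by
    simp only [hψ, hs]
    have : 1 - (1 : ℝ) ^ 2 * (1 - Real.cos θ ^ 2) = Real.cos θ ^ 2 := by ring
    rw [this]
    have : 1 + Real.cos θ ^ 2 - 1 ^ 2 * (1 - Real.cos θ ^ 2) = 2 * Real.cos θ ^ 2 := by ring
    rw [this]
    field_simp; ring
  have e2 : ψ (√(1 + Real.cos θ ^ 2)) = Real.cos θ ^ 4 + Real.cos θ ^ 2 := by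
    simp only [hψ, hs, Real.sq_sqrt (show 0 ≤ 1 + Real.cos θ ^ 2 by positivity)]
    have : 1 - (1 + Real.cos θ ^ 2) * (1 - Real.cos θ ^ 2) = Real.cos θ ^ 4 := by ring
    rw [this]
    have : 1 + Real.cos θ ^ 2 - (1 + Real.cos θ ^ 2) * (1 - Real.cos θ ^ 2)
      = Real.cos θ ^ 2 * (1 + Real.cos θ ^ 2) := by ring
    rw [this]
    field_simp; ring
  obtain ⟨ν, hν, hr⟩ := intermediate_value_Icc hle hcont (show r ∈ Set.Icc _ _ by
    rw [e1, e2]; exact ⟨h1, h2⟩)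
  refine ⟨ν, hν, fun u => ?_⟩
  rw [modelS3_eq, inner_pd_pd_torus, c1_sq hθ hν, c2_sq hθ hν, mu1_sq hθ hν, mu2_sq hθ hν]
  exact hr

end Parameters

end S3R

/-! ### Tangent plane and mean curvature in an arbitrary chart -/

namespace S3R

section SecondDerivative

/-- The last term of this second-order chain rule lies in the image of the differential of `f`, so
it is invisible to the normal projection. This makes the second fundamental form independent of the
chart. -/
theorem fderiv_fderiv_comp {f : Plane → E5} {τ : Plane → Plane} {u : Plane}
    (hf : ContDiffAt ℝ ∞ f (τ u)) (hτ : ContDiffAt ℝ ∞ τ u) (v w : Plane) :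
    fderiv ℝ (fderiv ℝ (f ∘ τ)) u v w
      = fderiv ℝ (fderiv ℝ f) (τ u) (fderiv ℝ τ u v) (fderiv ℝ τ u w)
        + fderiv ℝ f (τ u) (fderiv ℝ (fderiv ℝ τ) u v w) := by
  have h2 : (2 : WithTop ℕ∞) ≤ ∞ := by simpa using WithTop.coe_le_coe.2 (le_top (a := (2 : ℕ∞)))
  have hf2 := hf.of_le h2
  have hτ2 := hτ.of_le h2
  have e : fderiv ℝ (f ∘ τ) =ᶠ[nhds u] fun x => (fderiv ℝ f (τ x)).comp (fderiv ℝ τ x) := by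
    have h1 := hτ2.continuousAt.eventually (hf2.eventually (by simp))
    filter_upwards [h1, hτ2.eventually (by simp)] with x hx hx'
    exact fderiv_comp x (hx.differentiableAt (by simp)) (hx'.differentiableAt (by simp))
  have d1 : DifferentiableAt ℝ (fderiv ℝ f) (τ u) :=
    (hf2.fderiv_right (m := 1) (by norm_num)).differentiableAt (by simp)
  have d2 : DifferentiableAt ℝ (fderiv ℝ τ) u :=
    (hτ2.fderiv_right (m := 1) (by norm_num)).differentiableAt (by simp)
  have d3 := hτ2.differentiableAt (by simp)
  have d4 : HasFDerivAt (fun x => fderiv ℝ f (τ x))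
      ((fderiv ℝ (fderiv ℝ f) (τ u)).comp (fderiv ℝ τ u)) u :=
    d1.hasFDerivAt.comp u d3.hasFDerivAt
  rw [((d4.clm_comp d2.hasFDerivAt).congr_of_eventuallyEq e).fderiv, add_comm]
  rfl

/-- The metric trace can be taken in any orthonormal basis: if `K` has columns `v`, `w`, then `KᵀGK
= 1`, so `G⁻¹ = KKᵀ`. -/
theorem sum_inv_gram {D : Plane →L[ℝ] E5} (B : Plane →L[ℝ] Plane →L[ℝ] E5) {v w : Plane}
    (hv : inner ℝ (D v) (D v) = 1) (hvw : inner ℝ (D v) (D w) = 0)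
    (hw : inner ℝ (D w) (D w) = 1) :
    ∑ i, ∑ j, (Matrix.of fun i j =>
      (inner ℝ (D (coordVec i)) (D (coordVec j)) : ℝ))⁻¹ i j • B (coordVec i) (coordVec j)
      = B v v + B w w := by
  have hz : ∀ z : Plane, z = z 0 • coordVec 0 + z 1 • coordVec 1 := fun z => by
    ext j; fin_cases j <;> simp [coordVec]
  set G : Matrix (Fin 2) (Fin 2) ℝ := Matrix.of fun i j =>
    (inner ℝ (D (coordVec i)) (D (coordVec j)) : ℝ) with hG
  have hGin : ∀ z z' : Plane, (inner ℝ (D z) (D z') : ℝ) =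
      z 0 * z' 0 * G 0 0 + z 0 * z' 1 * G 0 1 + z 1 * z' 0 * G 1 0 + z 1 * z' 1 * G 1 1 := by
    intro z z'
    conv_lhs => rw [hz z, hz z']
    simp only [map_add, map_smul, inner_add_left, inner_add_right, inner_smul_left,
      inner_smul_right, hG, Matrix.of_apply, conj_trivial]
    ring
  set K : Matrix (Fin 2) (Fin 2) ℝ := !![v 0, w 0; v 1, w 1] with hK
  have hvw' : inner ℝ (D w) (D v) = 0 := by rw [real_inner_comm, hvw]
  rw [hGin] at hv hvw hw hvw'
  have h1 : K.transpose * G * K = 1 := by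
    ext i j
    fin_cases i <;> fin_cases j <;>
      simp [hK, Matrix.mul_apply, Fin.sum_univ_two] <;> linarith
  have h2 : K * K.transpose * G = 1 := by
    rw [Matrix.mul_assoc, mul_eq_one_comm]
    exact h1
  rw [Matrix.inv_eq_left_inv h2]
  conv_rhs => rw [hz v, hz w]
  simp only [hK, Fin.sum_univ_two, Matrix.mul_apply, Matrix.transpose_apply, map_add, map_smul,
    add_apply, smul_apply, Matrix.of_apply, Matrix.cons_val]
  module

end SecondDerivative

variable {M : Type*} [TopologicalSpace M]

/-- The surface read in the chart `e`. -/
noncomputable def param (F : M → S3xR) (e : OpenPartialHomeomorph M Plane) (u : Plane) : E5 :=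
  incl F (e.symm u)

theorem param_apply (F : M → S3xR) {e : OpenPartialHomeomorph M Plane} {q : M}
    (hq : q ∈ e.source) : param F e (e q) = incl F q := by
  rw [param, e.left_inv hq]

theorem norm_horiz_param (F : M → S3xR) (e : OpenPartialHomeomorph M Plane) (u : Plane) :
    ‖horiz (param F e u)‖ = 1 := (F (e.symm u)).2

section Charts

variable {F : M → S3xR} {e e' : OpenPartialHomeomorph M Plane}

theorem eventually_symm_mem_source {q : M} (hq : q ∈ e.source) (hq' : q ∈ e'.source) :
    ∀ᶠ u in nhds (e' q), u ∈ e'.target ∧ e'.symm u ∈ e.source := by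
  have h1 := e'.open_target.mem_nhds (e'.map_source hq')
  have h2 := e'.continuousAt_symm (e'.map_source hq')
  refine Filter.Eventually.and h1 (h2.eventually ?_)
  rw [e'.left_inv hq']
  exact e.open_source.mem_nhds hq

theorem param_eventuallyEq {q : M} (hq : q ∈ e.source) (hq' : q ∈ e'.source) :
    param F e' =ᶠ[nhds (e' q)] param F e ∘ (e ∘ e'.symm) := by
  filter_upwards [eventually_symm_mem_source hq hq'] with u hu
  simp [param, e.left_inv hu.2]

theorem contDiffAt_param (hs : ContDiffOn ℝ ∞ (param F e) e.target) {q : M}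
    (hq : q ∈ e.source) : ContDiffAt ℝ ∞ (param F e) (e q) :=
  hs.contDiffAt (e.open_target.mem_nhds (e.map_source hq))

variable [ChartedSpace Plane M]

theorem contDiffOn_param (he : e ∈ IsManifold.maximalAtlas (𝓡 2) ∞ M)
    (hF : ContMDiff (𝓡 2) 𝓘(ℝ, E5) ∞ (incl F)) : ContDiffOn ℝ ∞ (param F e) e.target :=
  contMDiffOn_iff_contDiffOn.1 (hF.comp_contMDiffOn (contMDiffOn_symm_of_mem_maximalAtlas he))

theorem contMDiffAt_of_param (he : e ∈ IsManifold.maximalAtlas (𝓡 2) ∞ M)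
    (h : ContDiffOn ℝ ∞ (param F e) e.target) {q : M} (hq : q ∈ e.source) :
    ContMDiffAt (𝓡 2) 𝓘(ℝ, E5) ∞ (incl F) q := by
  have h1 : ContMDiffAt 𝓘(ℝ, Plane) 𝓘(ℝ, E5) ∞ (param F e) (e q) :=
    (h.contDiffAt (e.open_target.mem_nhds (e.map_source hq))).contMDiffAt
  refine (h1.comp q (contMDiffAt_of_mem_maximalAtlas he hq)).congr_of_eventuallyEq ?_
  filter_upwards [e.open_source.mem_nhds hq] with x hx
  exact (param_apply F hx).symm

theorem contDiffAt_transition (he : e ∈ IsManifold.maximalAtlas (𝓡 2) ∞ M)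
    (he' : e' ∈ IsManifold.maximalAtlas (𝓡 2) ∞ M) {q : M} (hq : q ∈ e.source)
    (hq' : q ∈ e'.source) : ContDiffAt ℝ ∞ (e ∘ e'.symm) (e' q) := by
  refine contMDiffAt_iff_contDiffAt.1 (ContMDiffAt.comp (I' := 𝓡 2) (e' q) ?_ ?_)
  · rw [e'.left_inv hq']; exact contMDiffAt_of_mem_maximalAtlas he hq
  · exact contMDiffAt_symm_of_mem_maximalAtlas he' (e'.map_source hq')

theorem differential_eq {q : M} (hF : MDifferentiableAt (𝓡 2) 𝓘(ℝ, E5) (incl F) q) :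
    differential F q = fderiv ℝ (localParam F q) (chartAt Plane q q) := by
  unfold differential
  rw [hF.mfderiv]
  simp only [mfld_simps, fderivWithin_univ]
  rfl

/-- The differential of the preferred chart at `q`, read in the chart `e`. -/
noncomputable def chartDiff (e : OpenPartialHomeomorph M Plane) (q : M) : Plane →L[ℝ] Plane :=
  fderiv ℝ (e ∘ (chartAt Plane q).symm) (chartAt Plane q q)

theorem localParam_eventuallyEq {q : M} (hq : q ∈ e.source) :
    localParam F q =ᶠ[nhds (chartAt Plane q q)]
      param F e ∘ (e ∘ (chartAt Plane q).symm) :=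
  param_eventuallyEq (F := F) hq (mem_chart_source Plane q)

theorem fderiv_transition_comp (he : e ∈ IsManifold.maximalAtlas (𝓡 2) ∞ M)
    (he' : e' ∈ IsManifold.maximalAtlas (𝓡 2) ∞ M) {q : M} (hq : q ∈ e.source)
    (hq' : q ∈ e'.source) (v : Plane) :
    fderiv ℝ (e ∘ e'.symm) (e' q) (fderiv ℝ (e' ∘ e.symm) (e q) v) = v := by
  have h1 := (contDiffAt_transition he he' hq hq').differentiableAt (by simp)
  have h2 := (contDiffAt_transition he' he hq' hq).differentiableAt (by simp)
  have e1 : (e' ∘ e.symm) (e q) = e' q := by simp [e.left_inv hq]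
  have h3 := (e1.symm ▸ h1 : DifferentiableAt ℝ (e ∘ e'.symm) ((e' ∘ e.symm) (e q)))
  have h4 := fderiv_comp (e q) h3 h2
  have h5 : (e ∘ e'.symm) ∘ (e' ∘ e.symm) =ᶠ[nhds (e q)] id := by
    filter_upwards [eventually_symm_mem_source hq' hq] with u hu
    simp [e'.left_inv hu.2, e.right_inv hu.1]
  rw [h5.fderiv_eq, fderiv_id, e1] at h4
  exact (congrArg (fun A : Plane →L[ℝ] Plane => A v) h4).symm

variable [IsManifold (𝓡 2) ∞ M]

theorem chartDiff_surjective (he : e ∈ IsManifold.maximalAtlas (𝓡 2) ∞ M) {q : M}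
    (hq : q ∈ e.source) : Function.Surjective (chartDiff e q) := fun v =>
  ⟨_, fderiv_transition_comp he (IsManifold.chart_mem_maximalAtlas q) hq (mem_chart_source _ q) v⟩

theorem chartDiff_injective (he : e ∈ IsManifold.maximalAtlas (𝓡 2) ∞ M) {q : M}
    (hq : q ∈ e.source) : Function.Injective (chartDiff e q) :=
  Function.LeftInverse.injective (g := fderiv ℝ (chartAt Plane q ∘ e.symm) (e q)) fun v =>
    fderiv_transition_comp (IsManifold.chart_mem_maximalAtlas q) he (mem_chart_source _ q) hq v

theorem differential_eq_comp (he : e ∈ IsManifold.maximalAtlas (𝓡 2) ∞ M)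
    (hs : ContDiffOn ℝ ∞ (param F e) e.target) {q : M} (hq : q ∈ e.source) :
    differential F q = (fderiv ℝ (param F e) (e q)).comp (chartDiff e q) := by
  have h0 : (e ∘ (chartAt Plane q).symm) (chartAt Plane q q) = e q := by simp
  rw [differential_eq ((contMDiffAt_of_param he hs hq).mdifferentiableAt (by simp)),
    (localParam_eventuallyEq hq).fderiv_eq, fderiv_comp, h0]
  · rfl
  · rw [h0]; exact (contDiffAt_param hs hq).differentiableAt (by simp)
  · exact (contDiffAt_transition he (IsManifold.chart_mem_maximalAtlas q) hq
      (mem_chart_source _ q)).differentiableAt (by simp)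

theorem tangentPlane_eq (he : e ∈ IsManifold.maximalAtlas (𝓡 2) ∞ M)
    (hs : ContDiffOn ℝ ∞ (param F e) e.target) {q : M} (hq : q ∈ e.source) :
    tangentPlane F q = LinearMap.range (fderiv ℝ (param F e) (e q)).toLinearMap := by
  rw [tangentPlane, differential_eq_comp he hs hq]
  exact LinearMap.range_comp_of_range_eq_top _
    (LinearMap.range_eq_top.2 (chartDiff_surjective he hq))

theorem injective_mfderiv_iff (he : e ∈ IsManifold.maximalAtlas (𝓡 2) ∞ M)
    (hs : ContDiffOn ℝ ∞ (param F e) e.target) {q : M} (hq : q ∈ e.source) :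
    Function.Injective (mfderiv (𝓡 2) 𝓘(ℝ, E5) (incl F) q) ↔
      Function.Injective (fderiv ℝ (param F e) (e q)) := by
  have h := differential_eq_comp he hs hq
  change Function.Injective (differential F q) ↔ _
  rw [h, ContinuousLinearMap.coe_comp]
  exact Function.Injective.of_comp_iff' _
    ⟨chartDiff_injective he hq, chartDiff_surjective he hq⟩

theorem meanCurvature_eq (he : e ∈ IsManifold.maximalAtlas (𝓡 2) ∞ M)
    (hs : ContDiffOn ℝ ∞ (param F e) e.target) {q : M} (hq : q ∈ e.source) {v w : Plane}
    (hv : inner ℝ (fderiv ℝ (param F e) (e q) v) (fderiv ℝ (param F e) (e q) v) = 1)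
    (hvw : inner ℝ (fderiv ℝ (param F e) (e q) v) (fderiv ℝ (param F e) (e q) w) = 0)
    (hw : inner ℝ (fderiv ℝ (param F e) (e q) w) (fderiv ℝ (param F e) (e q) w) = 1) :
    meanCurvature F q = (1 / 2 : ℝ) • (normalPlane F q).starProjection
      (fderiv ℝ (fderiv ℝ (param F e)) (e q) v v
        + fderiv ℝ (fderiv ℝ (param F e)) (e q) w w) := by
  obtain ⟨v', rfl⟩ := chartDiff_surjective he hq v
  obtain ⟨w', rfl⟩ := chartDiff_surjective he hq w
  have hd := differential_eq_comp he hs hq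
  have hd' : ∀ z, differential F q z = fderiv ℝ (param F e) (e q) (chartDiff e q z) := fun z => by
    rw [hd]; rfl
  rw [← hd', ← hd'] at hvw
  rw [← hd'] at hv hw
  have h0 : (e ∘ (chartAt Plane q).symm) (chartAt Plane q q) = e q := by simp
  have hII : ∀ z z', secondFundamentalForm F q z z' = (normalPlane F q).starProjection
      (fderiv ℝ (fderiv ℝ (param F e)) (e q) (chartDiff e q z) (chartDiff e q z')) := by
    intro z z'
    have h1 := fderiv_fderiv_comp (f := param F e) (τ := e ∘ (chartAt Plane q).symm)
      (u := chartAt Plane q q) (by rw [h0]; exact contDiffAt_param hs hq)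
      (contDiffAt_transition he (IsManifold.chart_mem_maximalAtlas q) hq (mem_chart_source _ q))
      z z'
    rw [← ((localParam_eventuallyEq (F := F) hq).fderiv).fderiv_eq, h0] at h1
    rw [secondFundamentalForm, h1, map_add]
    -- The contribution of the second derivative of the chart transition is tangent to the surface.
    have h2 : (normalPlane F q).starProjection (fderiv ℝ (param F e) (e q)
        (fderiv ℝ (fderiv ℝ (e ∘ (chartAt Plane q).symm)) (chartAt Plane q q) z z')) = 0 := by
      rw [Submodule.starProjection_apply_eq_zero_iff, Submodule.mem_orthogonal']
      intro n hn
      have := hn.2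
      refine (Submodule.mem_orthogonal _ _).1 this _ ?_
      rw [tangentPlane_eq he hs hq]
      exact ⟨_, rfl⟩
    rw [h2, add_zero]
    rfl
  set P := (normalPlane F q).starProjection
  set B : Plane →L[ℝ] Plane →L[ℝ] E5 := (ContinuousLinearMap.compL ℝ Plane E5 E5 P).comp
    (((fderiv ℝ (fderiv ℝ (param F e)) (e q)).comp (chartDiff e q)).flip.comp
      (chartDiff e q)).flip with hB
  have hBz : ∀ z z', secondFundamentalForm F q z z' = B z z' := fun z z' => by
    rw [hII]; rfl
  rw [meanCurvature, metricMatrix]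
  simp only [hBz]
  rw [sum_inv_gram B hv hvw hw, ← hBz, ← hBz, hII, hII, map_add]

theorem meanCurvature_eq_zero_iff (he : e ∈ IsManifold.maximalAtlas (𝓡 2) ∞ M)
    (hs : ContDiffOn ℝ ∞ (param F e) e.target) {q : M} (hq : q ∈ e.source) {v w : Plane}
    (hv : inner ℝ (fderiv ℝ (param F e) (e q) v) (fderiv ℝ (param F e) (e q) v) = 1)
    (hvw : inner ℝ (fderiv ℝ (param F e) (e q) v) (fderiv ℝ (param F e) (e q) w) = 0)
    (hw : inner ℝ (fderiv ℝ (param F e) (e q) w) (fderiv ℝ (param F e) (e q) w) = 1) :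
    meanCurvature F q = 0 ↔ ∀ n ∈ normalPlane F q,
      inner ℝ (fderiv ℝ (fderiv ℝ (param F e)) (e q) v v
        + fderiv ℝ (fderiv ℝ (param F e)) (e q) w w) n = 0 := by
  rw [meanCurvature_eq he hs hq hv hvw hw, smul_eq_zero_iff_right (by norm_num),
    Submodule.starProjection_apply_eq_zero_iff, Submodule.mem_orthogonal']

end Charts

end S3R

/-! ### Locally explicit surfaces are minimal with constant angle -/

namespace S3R

/-- The first four components, as a continuous linear map. -/
noncomputable def horizL : E5 →L[ℝ] E4 :=
  LinearMap.toContinuousLinearMap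
    { toFun := horiz
      map_add' := fun _ _ => rfl
      map_smul' := fun _ _ => rfl }

theorem horiz_add (x y : E5) : horiz (x + y) = horiz x + horiz y := rfl

theorem horiz_smul (r : ℝ) (x : E5) : horiz (r • x) = r • horiz x := rfl

@[simp] theorem horiz_dt : horiz dt = 0 := by
  ext i; fin_cases i <;> simp [dt]

@[simp] theorem dt_apply_four : dt 4 = 1 := by simp [dt]

theorem inner_dt (x : E5) : (inner ℝ dt x : ℝ) = x 4 := by
  rw [inner_eq_horiz]; simp

@[simp] theorem horiz_unitN (x : E5) : horiz (unitN x) = horiz x := by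
  ext i; fin_cases i <;> simp [unitN]

@[simp] theorem unitN_apply_four (x : E5) : unitN x 4 = 0 := by simp [unitN]

theorem pd_horiz {f : Plane → E5} {u : Plane} (hf : DifferentiableAt ℝ f u) (i : Fin 2) :
    pd i (fun u => horiz (f u)) u = horiz (pd i f u) := by
  have := horizL.hasFDerivAt.comp u hf.hasFDerivAt
  rw [pd, show (fun u => horiz (f u)) = horizL ∘ f from rfl, this.fderiv]
  rfl

theorem contDiffOn_horiz {f : Plane → E5} {U : Set Plane} (hf : ContDiffOn ℝ ∞ f U) :
    ContDiffOn ℝ ∞ (fun u => horiz (f u)) U :=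
  horizL.contDiff.comp_contDiffOn hf

theorem pd_pd_horiz {f : Plane → E5} {U : Set Plane} (hU : IsOpen U) (hf : ContDiffOn ℝ ∞ f U)
    {u : Plane} (hu : u ∈ U) (i j : Fin 2) :
    pd i (pd j (fun u => horiz (f u))) u = horiz (pd i (pd j f) u) := by
  rw [pd_congr hU (fun v hv => pd_horiz (differentiableAt_of_contDiffOn hU hf hv) j) hu]
  exact pd_horiz (differentiableAt_of_contDiffOn hU (ContDiffOn.pd hU hf j) hu) i

theorem mem_normalPlane_iff {M : Type*} [TopologicalSpace M] [ChartedSpace Plane M]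
    {F : M → S3xR} {p : M} {n : E5} : n ∈ normalPlane F p ↔
      inner ℝ (unitN (F p)) n = 0 ∧ ∀ x ∈ tangentPlane F p, inner ℝ x n = 0 := by
  rw [normalPlane, Submodule.mem_inf, ambientTangent,
    Submodule.mem_orthogonal_singleton_iff_inner_right, Submodule.mem_orthogonal]

theorem fderiv_eq_pd {W : Type*} [NormedAddCommGroup W] [NormedSpace ℝ W] (h : Plane → W)
    (u z : Plane) : fderiv ℝ h u z = z 0 • pd 0 h u + z 1 • pd 1 h u := by
  have hz : z = z 0 • coordVec 0 + z 1 • coordVec 1 := by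
    ext j; fin_cases j <;> simp [coordVec]
  conv_lhs => rw [hz]
  simp [pd]

namespace FlatMinimal

variable {c : ℝ} {g g' : Plane → E4} {U : Set Plane}

theorem congr (h : FlatMinimal c g U) (hg : ∀ u ∈ U, g' u = g u) : FlatMinimal c g' U := by
  have h1 : ∀ u ∈ U, ∀ i, pd i g' u = pd i g u := fun u hu i => pd_congr h.isOpen hg hu i
  have h2 : ∀ u ∈ U, ∀ i j, pd i (pd j g') u = pd i (pd j g) u := fun u hu i j =>
    pd_congr h.isOpen (fun v hv => h1 v hv j) hu i
  refine ⟨h.isOpen, h.smooth.congr hg, fun u hu => ?_, fun u hu => ?_, fun u hu => ?_,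
    fun u hu => ?_, fun u hu => ?_⟩
  · rw [hg u hu]; exact h.unit u hu
  · rw [h1 u hu]; exact h.xx u hu
  · rw [h1 u hu, h1 u hu]; exact h.xy u hu
  · rw [h1 u hu]; exact h.yy u hu
  · rw [h2 u hu, h2 u hu, hg u hu]; exact h.harmonic u hu

theorem isometry_comp (h : FlatMinimal c g U) (L : E4 ≃ₗᵢ[ℝ] E4) :
    FlatMinimal c (fun u => L (g u)) U := by
  have key : ∀ (k : Plane → E4) i, pd i (fun u => L (k u)) = fun u => L (pd i k u) := by
    intro k i
    funext u
    have := L.toContinuousLinearEquiv.comp_fderiv (f := k) (x := u)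
    exact congrArg (fun A : Plane →L[ℝ] E4 => A (coordVec i)) this
  refine ⟨h.isOpen, ?_, fun u hu => ?_, fun u hu => ?_, fun u hu => ?_, fun u hu => ?_,
    fun u hu => ?_⟩
  · exact L.toContinuousLinearEquiv.contDiff.comp_contDiffOn h.smooth
  · rw [L.inner_map_map]; exact h.unit u hu
  · rw [key, L.inner_map_map]; exact h.xx u hu
  · rw [key, key, L.inner_map_map]; exact h.xy u hu
  · rw [key, L.inner_map_map]; exact h.yy u hu
  · rw [key, key, key, key, ← map_add, h.harmonic u hu, map_smul]

end FlatMinimal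

section Converse

variable {M : Type*} [TopologicalSpace M] {F : M → S3xR}
  {e : OpenPartialHomeomorph M Plane} {θ ε τ : ℝ}

theorem contDiffOn_of_horiz {f : Plane → E5} {U : Set Plane}
    (hg : ContDiffOn ℝ ∞ (fun u => horiz (f u)) U) {κ τ : ℝ}
    (h4 : ∀ u ∈ U, f u 4 = κ * u 0 + τ) : ContDiffOn ℝ ∞ f U := by
  rw [contDiffOn_euclidean] at hg ⊢
  intro i
  refine Fin.lastCases ?_ (fun j => hg j) i
  have : ContDiffOn ℝ ∞ (fun u : Plane => κ * u 0 + τ) U := by fun_prop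
  exact this.congr h4

theorem pd_affine (κ τ : ℝ) (i : Fin 2) (u : Plane) :
    pd i (fun u : Plane => κ * u 0 + τ) u = ![κ, 0] i := by
  have : HasFDerivAt (fun u : Plane => κ * u 0 + τ) (phase κ 0) u := by
    have h := (phase κ 0).hasFDerivAt (x := u)
    simpa [phase_apply, funext_iff] using h.add_const τ
  rw [pd, this.fderiv, phase_coordVec]

theorem pd_apply_four {f : Plane → E5} {U : Set Plane} (hU : IsOpen U)
    (hf : ContDiffOn ℝ ∞ f U) {κ τ : ℝ} (h4 : ∀ u ∈ U, f u 4 = κ * u 0 + τ) {u : Plane}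
    (hu : u ∈ U) (i : Fin 2) : pd i f u 4 = ![κ, 0] i := by
  rw [pd_apply (differentiableAt_of_contDiffOn hU hf hu), pd_congr hU h4 hu, pd_affine]

theorem pd_pd_apply_four {f : Plane → E5} {U : Set Plane} (hU : IsOpen U)
    (hf : ContDiffOn ℝ ∞ f U) {κ τ : ℝ} (h4 : ∀ u ∈ U, f u 4 = κ * u 0 + τ) {u : Plane}
    (hu : u ∈ U) (i j : Fin 2) : pd i (pd j f) u 4 = 0 := by
  rw [pd_apply (differentiableAt_of_contDiffOn hU (ContDiffOn.pd hU hf j) hu)]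
  exact pd_eq_zero hU (fun v hv => pd_apply_four hU hf h4 hv j) hu i

/-- The product form of `Φ` allows it to be undone: its orthogonal part preserves `FlatMinimal`, and
its part on the line leaves a sign `ε` and a shift `τ` in the height. -/
theorem flatMinimal_of_isModelNear {Φ : Isom} {ν : ℝ} (hθ : 0 < Real.cos θ)
    (hν : ν ∈ Set.Icc 1 (√(1 + Real.cos θ ^ 2)))
    (h : ∀ q ∈ e.source, (Φ.toEquiv (F q) : E5) = model θ ν (e q 0) (e q 1)) :
    FlatMinimal (Real.cos θ) (fun u => horiz (param F e u)) e.target ∧ ∃ ε τ : ℝ, ε ^ 2 = 1 ∧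
      ∀ u ∈ e.target, param F e u 4 = ε * Real.sin θ * u 0 + τ := by
  obtain ⟨L, ε, τ, hε, hΦ⟩ := Φ.exists_eq
  have key : ∀ u ∈ e.target, L (horiz (param F e u)) = modelS3 θ ν u ∧
      ε * param F e u 4 + τ = u 0 * Real.sin θ := fun u hu => by
    have h1 := h _ (e.map_target hu)
    rw [e.right_inv hu, model_eq] at h1
    have h2 := hΦ (F (e.symm u))
    rw [h1, horiz_pair, pair_apply_four] at h2
    exact ⟨h2.1.symm, h2.2.symm⟩
  refine ⟨?_, ε, -ε * τ, hε, fun u hu => ?_⟩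
  · refine (((flatMinimal_modelS3 hθ hν).isometry_comp L.symm).mono e.open_target
      (Set.subset_univ _)).congr fun u hu => ?_
    rw [← (key u hu).1, L.symm_apply_apply]
  · linear_combination ε * (key u hu).2 - param F e u 4 * hε

variable [ChartedSpace Plane M] [IsManifold (𝓡 2) ∞ M]

theorem minimal_of_flatMinimal (hc : Real.cos θ ≠ 0)
    (he : e ∈ IsManifold.maximalAtlas (𝓡 2) ∞ M)
    (h : FlatMinimal (Real.cos θ) (fun u => horiz (param F e u)) e.target)
    (hε : ε ^ 2 = 1) (h4 : ∀ u ∈ e.target, param F e u 4 = ε * Real.sin θ * u 0 + τ)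
    {q : M} (hq : q ∈ e.source) :
    ContMDiffAt (𝓡 2) 𝓘(ℝ, E5) ∞ (incl F) q ∧
    Function.Injective (mfderiv (𝓡 2) 𝓘(ℝ, E5) (incl F) q) ∧ meanCurvature F q = 0 ∧
    ∃ T ∈ tangentPlane F q, ∃ ξ ∈ normalPlane F q,
      ‖T‖ = 1 ∧ ‖ξ‖ = 1 ∧ dt = Real.sin θ • T + Real.cos θ • ξ := by
  set f := param F e with hf
  have ho := e.open_target
  have hs : ContDiffOn ℝ ∞ f e.target := contDiffOn_of_horiz h.smooth h4
  have hu := e.map_source hq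
  set u := e q with hu'
  have hfu : f u = F q := param_apply F hq
  have hsc := Real.sin_sq_add_cos_sq θ
  have d := fun i => pd_horiz (differentiableAt_of_contDiffOn ho hs hu) i
  have a0 : pd 0 f u 4 = ε * Real.sin θ := pd_apply_four ho hs h4 hu 0
  have a1 : pd 1 f u 4 = 0 := pd_apply_four ho hs h4 hu 1
  have hxx : inner ℝ (pd 0 f u) (pd 0 f u) = 1 := by
    rw [inner_eq_horiz, ← d, h.xx u hu, a0]
    linear_combination hsc + Real.sin θ ^ 2 * hε
  have hxy : inner ℝ (pd 0 f u) (pd 1 f u) = 0 := by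
    rw [inner_eq_horiz, ← d, ← d, h.xy u hu, a1]; simp
  have hyy : inner ℝ (pd 1 f u) (pd 1 f u) = 1 := by
    rw [inner_eq_horiz, ← d, h.yy u hu, a1]; simp
  have hyx : inner ℝ (pd 1 f u) (pd 0 f u) = 0 := by rw [real_inner_comm, hxy]
  have hT := tangentPlane_eq he hs hq
  refine ⟨contMDiffAt_of_param he hs hq, ?_, ?_, ?_⟩
  · rw [injective_mfderiv_iff he hs hq, injective_iff_map_eq_zero]
    intro z hz
    rw [fderiv_eq_pd] at hz
    have h0 := congrArg (fun x : E5 => (inner ℝ (pd 0 f u) x : ℝ)) hz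
    have h1 := congrArg (fun x : E5 => (inner ℝ (pd 1 f u) x : ℝ)) hz
    simp only [hf, hu'] at hxx hxy hyy hyx h0 h1
    simp only [inner_add_right, inner_smul_right, hxx, hxy, hyx, hyy,
      inner_zero_right] at h0 h1
    ext j
    fin_cases j
    · simpa using h0
    · simpa using h1
  · rw [meanCurvature_eq_zero_iff he hs hq (v := coordVec 0) (w := coordVec 1) hxx hxy hyy]
    intro n hn
    rw [← pd_pd_eq ho hs hu, ← pd_pd_eq ho hs hu]
    -- The coordinates are isometric, so the trace is the plain Laplacian. It is a multiple of the
    -- normal of `𝕊³ × ℝ`, hence orthogonal to the normal plane of the surface.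
    have hR : pd 0 (pd 0 f) u + pd 1 (pd 1 f) u = (-(1 + Real.cos θ ^ 2)) • unitN (F q) := by
      refine ext_horiz ?_ ?_
      · rw [horiz_add, ← pd_pd_horiz ho hs hu, ← pd_pd_horiz ho hs hu, h.harmonic u hu,
          horiz_smul, horiz_unitN, hfu]
      · rw [PiLp.add_apply, pd_pd_apply_four ho hs h4 hu, pd_pd_apply_four ho hs h4 hu,
          PiLp.smul_apply, unitN_apply_four]
        simp
    rw [hR, inner_smul_left, (mem_normalPlane_iff.1 hn).1, mul_zero]
  · have n0 : inner ℝ (unitN (F q)) (pd 0 f u) = 0 := by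
      rw [inner_eq_horiz, horiz_unitN, unitN_apply_four, ← d, ← hfu]
      simpa using h.pos_x hu
    have t1 : inner ℝ dt (ε • pd 0 f u) = Real.sin θ := by
      rw [inner_dt, PiLp.smul_apply, a0, smul_eq_mul]; linear_combination Real.sin θ * hε
    have t2 : inner ℝ (ε • pd 0 f u) (ε • pd 0 f u) = (1 : ℝ) := by
      rw [inner_smul_left, inner_smul_right, hxx]; simp; linear_combination hε
    have t3 : inner ℝ dt dt = (1 : ℝ) := by rw [inner_dt, dt_apply_four]
    -- The tangential part of `∂ₜ` is `ε sin θ • f_x`, because the height has derivative `ε sin θ`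
    -- along `x` and `0` along `y`. The vector `ξ` is the rescaled remainder.
    refine ⟨ε • pd 0 f u, ?_, (Real.cos θ)⁻¹ • (dt - Real.sin θ • ε • pd 0 f u),
      mem_normalPlane_iff.2 ⟨?_, ?_⟩, ?_, ?_, ?_⟩
    · rw [hT]; exact Submodule.smul_mem _ _ ⟨coordVec 0, rfl⟩
    · simp only [inner_smul_right, inner_sub_right, n0]
      rw [real_inner_comm, inner_dt]; simp
    · rw [hT]
      rintro _ ⟨z, rfl⟩
      change inner ℝ (fderiv ℝ f u z) _ = 0
      rw [fderiv_eq_pd]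
      simp only [inner_smul_right, inner_sub_right, inner_add_left, inner_smul_left, hxx, hyx,
        real_inner_comm dt, inner_dt, PiLp.add_apply, PiLp.smul_apply, smul_eq_mul, a0, a1,
        conj_trivial]
      ring
    · rw [norm_eq_sqrt_real_inner, t2, Real.sqrt_one]
    · rw [norm_eq_sqrt_real_inner]
      simp only [inner_smul_right (r := (Real.cos θ)⁻¹), inner_smul_left (r := (Real.cos θ)⁻¹),
        inner_sub_left, inner_sub_right, inner_smul_left (r := Real.sin θ),
        inner_smul_right (r := Real.sin θ), t1, t2, t3, real_inner_comm dt (ε • pd 0 f u),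
        conj_trivial]
      rw [show (1 : ℝ) - Real.sin θ * Real.sin θ - Real.sin θ * (Real.sin θ - Real.sin θ * 1)
        = Real.cos θ ^ 2 by linear_combination -hsc]
      field_simp
      simp
    · rw [smul_inv_smul₀ hc]; abel

theorem minimal_of_isModelNear (hθ : 0 < Real.cos θ)
    (h : ∀ p : M, ∃ ν ∈ Set.Icc 1 (√(1 + Real.cos θ ^ 2)), ∃ Φ : Isom,
      IsModelNear F Φ θ ν p) : IsImmersed F ∧ IsMinimal F ∧ HasConstantAngle F θ := by
  have key : ∀ p, ContMDiffAt (𝓡 2) 𝓘(ℝ, E5) ∞ (incl F) p ∧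
      Function.Injective (mfderiv (𝓡 2) 𝓘(ℝ, E5) (incl F) p) ∧ meanCurvature F p = 0 ∧
      ∃ T ∈ tangentPlane F p, ∃ ξ ∈ normalPlane F p,
        ‖T‖ = 1 ∧ ‖ξ‖ = 1 ∧ dt = Real.sin θ • T + Real.cos θ • ξ := fun p => by
    obtain ⟨ν, hν, Φ, e, he, hp, h⟩ := h p
    obtain ⟨h1, ε, τ, hε, h4⟩ := flatMinimal_of_isModelNear hθ hν h
    exact minimal_of_flatMinimal hθ.ne' he h1 hε h4 hp
  exact ⟨⟨fun p => (key p).1, fun p => (key p).2.1⟩, fun p => (key p).2.2.1,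
    fun p => (key p).2.2.2⟩

end Converse

end S3R

/-! ### Euclidean coordinates on a surface of constant angle -/

namespace S3R

theorem hasFDerivAt_eq_zero {U : Set Plane} (hU : IsOpen U) {k : Plane → ℝ} {C : ℝ}
    (hk : ∀ u ∈ U, k u = C) {u : Plane} (hu : u ∈ U) {k' : Plane →L[ℝ] ℝ}
    (h : HasFDerivAt k k' u) : k' = 0 :=
  h.unique ((hasFDerivAt_const C u).congr_of_eventuallyEq
    (Filter.eventuallyEq_of_mem (hU.mem_nhds hu) hk))

/-- A parametrized surface of `𝕊³ × ℝ ⊂ 𝔼⁵` with `∂ₜ = s T + c ξ`, whose mean curvature vector is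
orthogonal to `ξ`. -/
structure AngleSurface (s c : ℝ) (f : Plane → E5) (U : Set Plane) : Prop where
  isOpen : IsOpen U
  smooth : ContDiffOn ℝ ∞ f U
  injective : ∀ u ∈ U, Function.Injective (fderiv ℝ f u)
  angle : ∀ u ∈ U, ∃ v ξ, inner ℝ (fderiv ℝ f u v) (fderiv ℝ f u v) = (1 : ℝ) ∧
    (∀ z, inner ℝ ξ (fderiv ℝ f u z) = (0 : ℝ)) ∧ dt = s • fderiv ℝ f u v + c • ξ ∧
    ∀ w, inner ℝ (fderiv ℝ f u v) (fderiv ℝ f u w) = (0 : ℝ) →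
      inner ℝ (fderiv ℝ f u w) (fderiv ℝ f u w) = (1 : ℝ) →
      inner ℝ ξ (fderiv ℝ (fderiv ℝ f) u v v + fderiv ℝ (fderiv ℝ f) u w w) = (0 : ℝ)

theorem eq_inner_smul_add {D : Plane →L[ℝ] E5} {v w : Plane}
    (hv : inner ℝ (D v) (D v) = (1 : ℝ)) (hvw : inner ℝ (D v) (D w) = (0 : ℝ))
    (hw : inner ℝ (D w) (D w) = (1 : ℝ)) (z : Plane) :
    z = (inner ℝ (D v) (D z) : ℝ) • v + (inner ℝ (D w) (D z) : ℝ) • w := by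
  have hwv : inner ℝ (D w) (D v) = (0 : ℝ) := by rw [real_inner_comm, hvw]
  have hli : LinearIndependent ℝ ![v, w] := by
    rw [LinearIndependent.pair_iff]
    intro a b hab
    have h := congrArg D hab
    rw [map_add, map_smul, map_smul, map_zero] at h
    have h1 := congrArg (fun x : E5 => (inner ℝ (D v) x : ℝ)) h
    have h2 := congrArg (fun x : E5 => (inner ℝ (D w) x : ℝ)) h
    simp only [inner_add_right, inner_smul_right, hv, hvw, hw, hwv, inner_zero_right] at h1 h2
    constructor <;> linarith
  have hz : z ∈ Submodule.span ℝ (Set.range ![v, w]) := by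
    rw [hli.span_eq_top_of_card_eq_finrank (by simp)]; trivial
  rw [Matrix.range_cons, Matrix.range_cons, Matrix.range_empty, Set.union_empty,
    Set.singleton_union, Submodule.mem_span_pair] at hz
  obtain ⟨a, b, rfl⟩ := hz
  simp only [map_add, map_smul, inner_add_right, inner_smul_right, hv, hvw, hw, hwv]
  module

namespace AngleSurface

variable {s c : ℝ} {f : Plane → E5} {U : Set Plane}

theorem exists_unit_field (h : AngleSurface s c f U) (hs : s ≠ 0) :
    ∃ w : Plane → Plane, ContDiffOn ℝ ∞ w U ∧ ∀ u ∈ U,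
      inner ℝ (fderiv ℝ f u (w u)) (fderiv ℝ f u (w u)) = (1 : ℝ) ∧
      inner ℝ dt (fderiv ℝ f u (w u)) = (0 : ℝ) := by
  have h4 : ∀ i, ContDiffOn ℝ ∞ (fun u => pd i f u 4) U := fun i =>
    contDiffOn_euclidean.1 (ContDiffOn.pd h.isOpen h.smooth i) 4
  -- `W` spans the kernel of the differential of the height. That differential is nonzero, since it
  -- takes the value `s` on `T`.
  set W : Plane → Plane := fun u => pd 1 f u 4 • coordVec 0 - pd 0 f u 4 • coordVec 1 with hW
  have sW : ContDiffOn ℝ ∞ W U := ((h4 1).smul contDiffOn_const).sub ((h4 0).smul contDiffOn_const)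
  have hW0 : ∀ u ∈ U, W u ≠ 0 := by
    intro u hu h0
    obtain ⟨v, ξ, hv, hξ, hdt, -⟩ := h.angle u hu
    have e0 : pd 1 f u 4 = 0 := by
      simpa [hW, coordVec] using congrArg (fun z : Plane => z 0) h0
    have e1 : pd 0 f u 4 = 0 := by
      simpa [hW, coordVec] using congrArg (fun z : Plane => z 1) h0
    have e2 : inner ℝ dt (fderiv ℝ f u v) = (0 : ℝ) := by
      rw [inner_dt, fderiv_eq_pd, PiLp.add_apply, PiLp.smul_apply, PiLp.smul_apply, e0, e1]; simp
    rw [hdt, inner_add_left, inner_smul_left, inner_smul_left, hv, hξ] at e2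
    simp [hs] at e2
  have sZ : ContDiffOn ℝ ∞ (fun u => fderiv ℝ f u (W u)) U :=
    (contDiffOn_fderiv h.isOpen h.smooth).clm_apply sW
  have hZ0 : ∀ u ∈ U, fderiv ℝ f u (W u) ≠ 0 := fun u hu h0 =>
    hW0 u hu (h.injective u hu (by rw [h0, map_zero]))
  refine ⟨fun u => ‖fderiv ℝ f u (W u)‖⁻¹ • W u,
    ((sZ.norm ℝ hZ0).inv fun u hu => norm_ne_zero_iff.2 (hZ0 u hu)).smul sW, fun u hu => ?_⟩
  have hn := norm_ne_zero_iff.2 (hZ0 u hu)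
  rw [map_smul, inner_smul_left, inner_smul_right, inner_smul_right, real_inner_self_eq_norm_sq]
  refine ⟨by simp only [conj_trivial]; field_simp, ?_⟩
  rw [inner_dt, fderiv_eq_pd]
  simp [hW, coordVec]
  ring_nf
  simp

/-- Every angle surface admits a second coordinate: a function whose differential is the one-form
dual to the unit tangent field orthogonal to `∂ₜ`. -/
theorem exists_primitive (h : AngleSurface s c f U) (hs : s ≠ 0) (hc : c ≠ 0) {u₀ : Plane}
    (hu₀ : u₀ ∈ U) : ∃ V ⊆ U, u₀ ∈ V ∧ IsOpen V ∧ ∃ y : Plane → ℝ, ContDiffOn ℝ ∞ y V ∧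
      ∀ u ∈ V, ∀ z, inner ℝ (fderiv ℝ f u z) (fderiv ℝ f u z)
        = (inner ℝ dt (fderiv ℝ f u z) / s) ^ 2 + (fderiv ℝ y u z) ^ 2 := by
  obtain ⟨w, sw, hw⟩ := h.exists_unit_field hs
  have ho := h.isOpen
  have sf := contDiffOn_fderiv ho h.smooth
  set Y : Plane → E5 := fun u => fderiv ℝ f u (w u) with hY
  have sY : ContDiffOn ℝ ∞ Y U := sf.clm_apply sw
  have hvw : ∀ u ∈ U, ∀ v ξ, (∀ z, inner ℝ ξ (fderiv ℝ f u z) = (0 : ℝ)) →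
      dt = s • fderiv ℝ f u v + c • ξ → inner ℝ (fderiv ℝ f u v) (Y u) = (0 : ℝ) := by
    intro u hu v ξ hξ hdt
    have := (hw u hu).2
    rw [hdt, inner_add_left, inner_smul_left, inner_smul_left, hξ] at this
    simpa [hs] using this
  -- This is the expansion of the metric in the orthonormal pair `T`, `Y`, with `T` eliminated
  -- through `∂ₜ`. Only objects smooth in `u` remain, so it can be differentiated although `v` and
  -- `ξ` are known pointwise only.
  have metric : ∀ u ∈ U, ∀ z, s ^ 2 * inner ℝ (fderiv ℝ f u z) (fderiv ℝ f u z)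
      - inner ℝ dt (fderiv ℝ f u z) * inner ℝ dt (fderiv ℝ f u z)
      - s ^ 2 * (inner ℝ (Y u) (fderiv ℝ f u z) * inner ℝ (Y u) (fderiv ℝ f u z)) = 0 := by
    intro u hu z
    obtain ⟨v, ξ, hv, hξ, hdt, -⟩ := h.angle u hu
    have h1 := hvw u hu v ξ hξ hdt
    have h2 := (hw u hu).1
    have h3 := eq_inner_smul_add hv h1 h2 z
    have h4 : inner ℝ dt (fderiv ℝ f u z) = s * inner ℝ (fderiv ℝ f u v) (fderiv ℝ f u z) := by
      rw [hdt, inner_add_left, inner_smul_left, inner_smul_left, hξ]; simp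
    have h5 : inner ℝ (fderiv ℝ f u z) (fderiv ℝ f u z)
        = inner ℝ (fderiv ℝ f u v) (fderiv ℝ f u z) * inner ℝ (fderiv ℝ f u v) (fderiv ℝ f u z)
          + inner ℝ (Y u) (fderiv ℝ f u z) * inner ℝ (Y u) (fderiv ℝ f u z) := by
      nth_rewrite 1 [h3]
      rw [map_add, map_smul, map_smul, inner_add_left, inner_smul_left, inner_smul_left]
      rfl
    rw [h4, h5]; ring
  have dDf : ∀ u ∈ U, ∀ z, HasFDerivAt (fun u => fderiv ℝ f u z)
      ((fderiv ℝ (fderiv ℝ f) u).flip z) u := fun u hu z => by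
    have := (differentiableAt_of_contDiffOn ho sf hu).hasFDerivAt.clm_apply (hasFDerivAt_const z u)
    simpa using this
  have dY : ∀ u ∈ U, HasFDerivAt Y (fderiv ℝ Y u) u := fun u hu =>
    (differentiableAt_of_contDiffOn ho sY hu).hasFDerivAt
  -- `Y` is parallel: its derivative has no component along `Y`, which is a unit field, and none
  -- along `∂ₜ`. So the component along `T` is a multiple of that along `ξ`, which is shown to
  -- vanish.
  have orth : ∀ u ∈ U, ∀ z z', inner ℝ (fderiv ℝ Y u z) (fderiv ℝ f u z') = (0 : ℝ) := by
    intro u hu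
    obtain ⟨v, ξ, hv, hξ, hdt, hmin⟩ := h.angle u hu
    have h1 := hvw u hu v ξ hξ hdt
    have h2 := (hw u hu).1
    have YY : ∀ z, inner ℝ (Y u) (fderiv ℝ Y u z) = (0 : ℝ) := fun z => by
      have := hasFDerivAt_eq_zero ho (fun u hu => (hw u hu).1) hu ((dY u hu).inner ℝ (dY u hu))
      have := congrArg (fun A : Plane →L[ℝ] ℝ => A z) this
      simp only [ContinuousLinearMap.comp_apply, fderivInnerCLM_apply,
        ContinuousLinearMap.prod_apply, zero_apply] at this
      rw [real_inner_comm (Y u)] at this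
      linarith
    have Yt : ∀ z, inner ℝ dt (fderiv ℝ Y u z) = (0 : ℝ) := fun z => by
      have := hasFDerivAt_eq_zero ho (fun u hu => (hw u hu).2) hu
        ((hasFDerivAt_const dt u).inner ℝ (dY u hu))
      have := congrArg (fun A : Plane →L[ℝ] ℝ => A z) this
      simpa [fderivInnerCLM_apply] using this
    have Yξ : ∀ z, inner ℝ ξ (fderiv ℝ Y u z)
        = (inner ℝ ξ (fderiv ℝ (fderiv ℝ f) u z (w u)) : ℝ) := fun z => by
      have := (differentiableAt_of_contDiffOn ho sf hu).hasFDerivAt.clm_apply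
        (differentiableAt_of_contDiffOn ho sw hu).hasFDerivAt
      rw [hY, this.fderiv]
      simp only [add_apply, ContinuousLinearMap.comp_apply, ContinuousLinearMap.flip_apply,
        inner_add_right, hξ, zero_add]
    -- Differentiate `metric` with the vector `v` frozen at its value at `u`. Everything cancels
    -- except `2sc` times the pairing of `ξ` with the second derivative.
    have vξ : ∀ z, inner ℝ ξ (fderiv ℝ (fderiv ℝ f) u z v) = (0 : ℝ) := fun z => by
      have dz := dDf u hu v
      have dd := (dz.inner ℝ dz).const_mul (s ^ 2)
      have dt1 := (hasFDerivAt_const dt u).inner ℝ dz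
      have dy1 := (dY u hu).inner ℝ dz
      have := hasFDerivAt_eq_zero ho (fun u hu => metric u hu v) hu
        ((dd.fun_sub (dt1.fun_mul dt1)).fun_sub ((dy1.fun_mul dy1).const_mul (s ^ 2)))
      have := congrArg (fun A : Plane →L[ℝ] ℝ => A z) this
      simp only [ContinuousLinearMap.comp_apply, fderivInnerCLM_apply, sub_apply, smul_apply,
        add_apply, ContinuousLinearMap.prod_apply, zero_apply, ContinuousLinearMap.flip_apply,
        real_inner_comm (fderiv ℝ f u v) (Y u), h1, inner_zero_left, smul_eq_mul] at this
      rw [real_inner_comm (fderiv ℝ f u v) (fderiv ℝ (fderiv ℝ f) u z v)] at this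
      have e1 : inner ℝ dt (fderiv ℝ f u v) = s := by
        rw [hdt, inner_add_left, inner_smul_left, inner_smul_left, hξ, hv]; simp
      have e2 : inner ℝ dt (fderiv ℝ (fderiv ℝ f) u z v)
          = s * inner ℝ (fderiv ℝ f u v) (fderiv ℝ (fderiv ℝ f) u z v)
            + c * inner ℝ ξ (fderiv ℝ (fderiv ℝ f) u z v) := by
        rw [hdt, inner_add_left, inner_smul_left, inner_smul_left]; rfl
      rw [e1, e2] at this
      have : (2 * s * c) * inner ℝ ξ (fderiv ℝ (fderiv ℝ f) u z v) = 0 := by linarith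
      exact (mul_eq_zero.1 this).resolve_left (by simp [hs, hc])
    -- The entry `(v, w)` vanishes by symmetry and `vξ`. The entry `(w, w)` vanishes because the
    -- trace is zero by minimality.
    have wξ : ∀ z, inner ℝ ξ (fderiv ℝ (fderiv ℝ f) u z (w u)) = (0 : ℝ) := fun z => by
      have e1 : inner ℝ ξ (fderiv ℝ (fderiv ℝ f) u v (w u)) = (0 : ℝ) := by
        rw [fderiv_fderiv_symm ho h.smooth hu, vξ]
      have e2 : inner ℝ ξ (fderiv ℝ (fderiv ℝ f) u (w u) (w u)) = (0 : ℝ) := by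
        have := hmin (w u) h1 h2
        rwa [inner_add_right, vξ, zero_add] at this
      rw [eq_inner_smul_add hv h1 h2 z]
      simp only [map_add, map_smul, add_apply, smul_apply, inner_add_right, inner_smul_right, e1,
        e2, mul_zero, add_zero]
    intro z z'
    have Yv : inner ℝ (fderiv ℝ f u v) (fderiv ℝ Y u z) = (0 : ℝ) := by
      have := Yt z
      rw [hdt, inner_add_left, inner_smul_left, inner_smul_left, Yξ, wξ] at this
      simpa [hs] using this
    rw [real_inner_comm, eq_inner_smul_add hv h1 h2 z', map_add, map_smul, map_smul,
      inner_add_left, inner_smul_left, inner_smul_left, Yv]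
    have := YY z
    simp only [hY] at this
    rw [this]; simp
  set α : Plane → Plane →L[ℝ] ℝ := fun u => (innerSL ℝ (Y u)).comp (fderiv ℝ f u) with hα
  have sα : ContDiffOn ℝ ∞ α U :=
    ((innerSL ℝ : E5 →L[ℝ] E5 →L[ℝ] ℝ).contDiff.comp_contDiffOn sY).clm_comp sf
  have dα : ∀ u ∈ U, ∀ z z', fderiv ℝ α u z z'
      = inner ℝ (Y u) (fderiv ℝ (fderiv ℝ f) u z z') := by
    intro u hu z z'
    have e1 := ((differentiableAt_of_contDiffOn ho sα hu).hasFDerivAt.clm_apply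
      (hasFDerivAt_const z' u))
    have e2 : HasFDerivAt (fun u => α u z') _ u := (dY u hu).inner ℝ (dDf u hu z')
    have := congrArg (fun A : Plane →L[ℝ] ℝ => A z) (e1.unique e2)
    simp only [ContinuousLinearMap.comp_apply, fderivInnerCLM_apply, add_apply,
      ContinuousLinearMap.prod_apply, zero_apply, ContinuousLinearMap.flip_apply, map_zero,
      zero_add] at this
    exact this.trans (add_eq_left.2 (orth u hu z z'))
  -- By `orth` the derivative of `α = ⟨Y, df⟩` reduces to `⟨Y, D²f⟩`, which is symmetric. Thus `α`
  -- is closed, and exact on a ball.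
  obtain ⟨r, hr, hrU⟩ := Metric.isOpen_iff.1 ho u₀ hu₀
  obtain ⟨y, hy⟩ := (convex_ball u₀ r).exists_forall_hasFDerivAt_of_fderiv_symmetric
    Metric.isOpen_ball ((sα.mono hrU).differentiableOn (by simp)) fun u hu z z' => by
      rw [dα u (hrU hu), dα u (hrU hu), fderiv_fderiv_symm ho h.smooth (hrU hu)]
  refine ⟨Metric.ball u₀ r, hrU, Metric.mem_ball_self hr, Metric.isOpen_ball, y, ?_, ?_⟩
  · rw [contDiffOn_infty_iff_fderiv_of_isOpen Metric.isOpen_ball]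
    exact ⟨fun u hu => (hy u hu).differentiableAt.differentiableWithinAt,
      (sα.mono hrU).congr fun u hu => (hy u hu).fderiv⟩
  · intro u hu z
    have h1 := metric u (hrU hu) z
    rw [(hy u hu).fderiv]
    change _ = _ + (inner ℝ (Y u) (fderiv ℝ f u z)) ^ 2
    rw [div_pow]
    field_simp
    linarith

/-- Every angle surface admits local coordinates in which the metric is Euclidean and the first
coordinate is proportional to the height. -/
theorem exists_coordinates (h : AngleSurface s c f U) (hs : s ≠ 0) (hc : c ≠ 0) {u₀ : Plane}
    (hu₀ : u₀ ∈ U) : ∃ V ⊆ U, u₀ ∈ V ∧ IsOpen V ∧ ∃ ψ : Plane → Plane, ContDiffOn ℝ ∞ ψ V ∧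
      ∀ u ∈ V, f u 4 = s * ψ u 0 ∧ ∀ z, ‖fderiv ℝ f u z‖ = ‖fderiv ℝ ψ u z‖ := by
  obtain ⟨V, hVU, huV, hV, y, sy, hy⟩ := h.exists_primitive hs hc hu₀
  have sf4 : ContDiffOn ℝ ∞ (fun u => f u 4) V := contDiffOn_euclidean.1 (h.smooth.mono hVU) 4
  have sψ : ContDiffOn ℝ ∞ (fun u => (!₂[f u 4 / s, y u] : Plane)) V := by
    rw [contDiffOn_euclidean]
    intro i
    fin_cases i
    · simpa using sf4.div_const s
    · simpa using sy
  refine ⟨V, hVU, huV, hV, _, sψ, fun u hu => ⟨?_, fun z => ?_⟩⟩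
  · simp; field_simp
  · have dψ := differentiableAt_of_contDiffOn hV sψ hu
    have df := differentiableAt_of_contDiffOn hV (h.smooth.mono hVU) hu
    have key : ∀ {n : ℕ} {k : Plane → EuclideanSpace ℝ (Fin n)}, DifferentiableAt ℝ k u →
        ∀ j, fderiv ℝ k u z j = fderiv ℝ (fun u => k u j) u z := by
      intro n k hk j
      have := (EuclideanSpace.proj j : EuclideanSpace ℝ (Fin n) →L[ℝ] ℝ).hasFDerivAt.comp u
        hk.hasFDerivAt
      exact (congrArg (fun A : Plane →L[ℝ] ℝ => A z) this.fderiv).symm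
    have e0 : fderiv ℝ (fun u => f u 4 / s) u z = inner ℝ dt (fderiv ℝ f u z) / s := by
      have d4 := (differentiableAt_of_contDiffOn hV sf4 hu).hasFDerivAt.mul_const s⁻¹
      simp only [div_eq_mul_inv]
      rw [d4.fderiv, inner_dt, key df, smul_apply, smul_eq_mul, mul_comm]
    rw [← sq_eq_sq₀ (norm_nonneg _) (norm_nonneg _), ← real_inner_self_eq_norm_sq, hy u hu,
      EuclideanSpace.norm_sq_eq, Fin.sum_univ_two, key dψ, key dψ]
    simp only [Matrix.cons_val, Real.norm_eq_abs, sq_abs, e0]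

end AngleSurface

/-- The inverse function theorem for smooth maps of the plane. -/
theorem exists_openPartialHomeomorph {V : Set Plane} (hV : IsOpen V) {ψ : Plane → Plane}
    (hψ : ContDiffOn ℝ ∞ ψ V) (hinj : ∀ u ∈ V, Function.Injective (fderiv ℝ ψ u)) {u₀ : Plane}
    (hu₀ : u₀ ∈ V) : ∃ τ : OpenPartialHomeomorph Plane Plane, u₀ ∈ τ.source ∧ τ.source ⊆ V ∧
      (∀ u, τ u = ψ u) ∧ ContDiffOn ℝ ∞ τ.symm τ.target := by
  have heq : ∀ u ∈ V, ∃ A : Plane ≃L[ℝ] Plane, HasFDerivAt ψ (A : Plane →L[ℝ] Plane) u := by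
    intro u hu
    refine ⟨(LinearEquiv.ofInjectiveEndo (fderiv ℝ ψ u).toLinearMap
      (hinj u hu)).toContinuousLinearEquiv, ?_⟩
    exact (differentiableAt_of_contDiffOn hV hψ hu).hasFDerivAt
  obtain ⟨A, hA⟩ := heq u₀ hu₀
  set τ₀ := (hψ.contDiffAt (hV.mem_nhds hu₀)).toOpenPartialHomeomorph ψ hA (by simp) with hτ₀
  have hco : ∀ u, τ₀ u = ψ u := fun u => rfl
  -- After restriction to `V` the differential is invertible on the whole source, so the inverse is
  -- smooth on the whole target and not only at the image of `u₀`.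
  refine ⟨τ₀.restrOpen V hV, ⟨(hψ.contDiffAt
    (hV.mem_nhds hu₀)).mem_toOpenPartialHomeomorph_source hA (by simp), hu₀⟩,
    fun u hu => hu.2, hco, ?_⟩
  intro u hu
  have hu' : (τ₀.restrOpen V hV).symm u ∈ V := ((τ₀.restrOpen V hV).map_target hu).2
  obtain ⟨B, hB⟩ := heq _ hu'
  exact ((τ₀.restrOpen V hV).contDiffAt_symm hu hB
    (hψ.contDiffAt (hV.mem_nhds hu'))).contDiffWithinAt

end S3R

/-! ### Local classification -/

namespace S3R

variable {M : Type*} [TopologicalSpace M] [ChartedSpace Plane M] [IsManifold (𝓡 2) ∞ M]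
  {F : M → S3xR} {e : OpenPartialHomeomorph M Plane} {θ : ℝ}

theorem trans_mem_maximalAtlas (he : e ∈ IsManifold.maximalAtlas (𝓡 2) ∞ M)
    {τ : OpenPartialHomeomorph Plane Plane} (h : ContDiffOn ℝ ∞ τ τ.source)
    (h' : ContDiffOn ℝ ∞ τ.symm τ.target) :
    e.trans τ ∈ IsManifold.maximalAtlas (𝓡 2) ∞ M := by
  refine OpenPartialHomeomorph.mem_maximalAtlas_of_contMDiffOn _ ?_ ?_
  · have h1 : ContMDiffOn (𝓡 2) (𝓡 2) ∞ τ τ.source := contMDiffOn_iff_contDiffOn.2 h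
    exact h1.comp ((contMDiffOn_of_mem_maximalAtlas he).mono fun x hx => hx.1) fun x hx => hx.2
  · have h1 : ContMDiffOn (𝓡 2) (𝓡 2) ∞ τ.symm τ.target := contMDiffOn_iff_contDiffOn.2 h'
    refine (contMDiffOn_symm_of_mem_maximalAtlas he).comp (h1.mono fun x hx => hx.1)
      fun x hx => hx.2

theorem angleSurface_param (hF : IsImmersed F) (hmin : IsMinimal F) (hang : HasConstantAngle F θ)
    (he : e ∈ IsManifold.maximalAtlas (𝓡 2) ∞ M) :
    AngleSurface (Real.sin θ) (Real.cos θ) (param F e) e.target := by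
  have hs := contDiffOn_param he hF.1
  refine ⟨e.open_target, hs, fun u hu => ?_, fun u hu => ?_⟩
  · have h := (injective_mfderiv_iff he hs (e.map_target hu)).1 (hF.2 _)
    rwa [e.right_inv hu] at h
  · obtain ⟨T, hT, ξ, hξ, hT1, -, hdt⟩ := hang (e.symm u)
    have hT' := hT
    rw [tangentPlane_eq he hs (e.map_target hu), e.right_inv hu] at hT'
    obtain ⟨v, rfl⟩ := hT'
    change ‖fderiv ℝ (param F e) u v‖ = 1 at hT1
    have hv : inner ℝ (fderiv ℝ (param F e) u v) (fderiv ℝ (param F e) u v) = (1 : ℝ) := by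
      rw [real_inner_self_eq_norm_sq, hT1, one_pow]
    refine ⟨v, ξ, hv, fun z => ?_, hdt, fun w hvw hw => ?_⟩
    · rw [real_inner_comm]
      refine (mem_normalPlane_iff.1 hξ).2 _ ?_
      rw [tangentPlane_eq he hs (e.map_target hu), e.right_inv hu]
      exact ⟨z, rfl⟩
    · rw [real_inner_comm]
      have := meanCurvature_eq_zero_iff (F := F) he hs (e.map_target hu) (v := v) (w := w)
      rw [e.right_inv hu] at this
      exact (this hv hvw hw).1 (hmin _) ξ hξ

/-- In isometric coordinates the Laplacian of `f` is orthogonal to the surface, and its component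
along the normal `N` of `𝕊³ × ℝ` is `-|dg|² = -(1 + cos² θ)`. Minimality removes every other
component. -/
theorem flatMinimal_of_isometric (hF : IsImmersed F) (hmin : IsMinimal F)
    (he : e ∈ IsManifold.maximalAtlas (𝓡 2) ∞ M)
    (hiso : ∀ u ∈ e.target, ∀ z, ‖fderiv ℝ (param F e) u z‖ = ‖z‖)
    (h4 : ∀ u ∈ e.target, param F e u 4 = Real.sin θ * u 0) :
    FlatMinimal (Real.cos θ) (fun u => horiz (param F e u)) e.target := by
  have hs := contDiffOn_param he hF.1
  set f := param F e with hf
  have ho := e.open_target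
  have hcs := Real.cos_sq' θ
  have h4' : ∀ u ∈ e.target, f u 4 = Real.sin θ * u 0 + 0 := fun u hu => by rw [h4 u hu, add_zero]
  have d := fun i u hu => pd_horiz (differentiableAt_of_contDiffOn ho hs hu) i (u := u)
  have a0 : ∀ u ∈ e.target, pd 0 f u 4 = Real.sin θ := fun u hu => pd_apply_four ho hs h4' hu 0
  have a1 : ∀ u ∈ e.target, pd 1 f u 4 = 0 := fun u hu => pd_apply_four ho hs h4' hu 1
  have hpol : ∀ u ∈ e.target, ∀ i j, (inner ℝ (pd i f u) (pd j f u) : ℝ)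
      = inner ℝ (coordVec i) (coordVec j) := by
    intro u hu i j
    have e1 : ∀ z, inner ℝ (fderiv ℝ f u z) (fderiv ℝ f u z) = (inner ℝ z z : ℝ) := fun z => by
      rw [real_inner_self_eq_norm_sq, hiso u hu, real_inner_self_eq_norm_sq]
    have e2 := e1 (coordVec i + coordVec j)
    rw [map_add, real_inner_add_add_self, real_inner_add_add_self, e1, e1] at e2
    simp only [pd]
    linarith
  have hxx : ∀ u ∈ e.target, (inner ℝ (pd 0 f u) (pd 0 f u) : ℝ) = 1 := fun u hu => by
    rw [hpol u hu]; simp [coordVec]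
  have hxy : ∀ u ∈ e.target, (inner ℝ (pd 0 f u) (pd 1 f u) : ℝ) = 0 := fun u hu => by
    rw [hpol u hu]; simp [coordVec, EuclideanSpace.inner_single_left]
  have hyy : ∀ u ∈ e.target, (inner ℝ (pd 1 f u) (pd 1 f u) : ℝ) = 1 := fun u hu => by
    rw [hpol u hu]; simp [coordVec]
  set g : Plane → E4 := fun u => horiz (f u) with hg
  have sg : ContDiffOn ℝ ∞ g e.target := contDiffOn_horiz hs
  have gg : ∀ u ∈ e.target, (inner ℝ (g u) (g u) : ℝ) = 1 := fun u hu => by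
    rw [real_inner_self_eq_norm_sq, hg, norm_horiz_param, one_pow]
  have gxx : ∀ u ∈ e.target, (inner ℝ (pd 0 g u) (pd 0 g u) : ℝ) = Real.cos θ ^ 2 :=
    fun u hu => by
      have := hxx u hu
      rw [inner_eq_horiz, ← d 0 u hu, a0 u hu] at this
      rw [hcs]; linarith
  have gxy : ∀ u ∈ e.target, (inner ℝ (pd 0 g u) (pd 1 g u) : ℝ) = 0 := fun u hu => by
    have := hxy u hu
    rwa [inner_eq_horiz, ← d 0 u hu, ← d 1 u hu, a1 u hu, mul_zero, add_zero] at this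
  have gyy : ∀ u ∈ e.target, (inner ℝ (pd 1 g u) (pd 1 g u) : ℝ) = 1 := fun u hu => by
    have := hyy u hu
    rwa [inner_eq_horiz, ← d 1 u hu, a1 u hu, mul_zero, add_zero] at this
  refine ⟨ho, sg, gg, gxx, gxy, gyy, fun u hu => ?_⟩
  have g_i : ∀ i, ∀ u ∈ e.target, (inner ℝ (g u) (pd i g u) : ℝ) = 0 := fun i u hu => by
    have := inner_pd_add_inner_pd ho sg sg gg i hu
    rw [real_inner_comm] at this; linarith
  have g_xx := inner_pd_add_inner_pd ho sg (ContDiffOn.pd ho sg 0) (g_i 0) 0 hu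
  have g_yy := inner_pd_add_inner_pd ho sg (ContDiffOn.pd ho sg 1) (g_i 1) 1 hu
  rw [gxx u hu] at g_xx
  rw [gyy u hu] at g_yy
  have sx := ContDiffOn.pd ho hs 0
  have sy := ContDiffOn.pd ho hs 1
  have hcomm := pd_comm ho hs hu 1 0
  have x_xx := inner_pd_add_inner_pd ho sx sx hxx 0 hu
  have x_xy := inner_pd_add_inner_pd ho sx sx hxx 1 hu
  have y_xy := inner_pd_add_inner_pd ho sy sy hyy 0 hu
  have y_yy := inner_pd_add_inner_pd ho sy sy hyy 1 hu
  have xx_y := inner_pd_add_inner_pd ho sx sy hxy 0 hu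
  have xy_y := inner_pd_add_inner_pd ho sx sy hxy 1 hu
  rw [real_inner_comm] at x_xx x_xy y_xy y_yy xx_y
  rw [hcomm] at x_xy xy_y
  rw [real_inner_comm] at xy_y
  set X := pd 0 (pd 0 f) u + pd 1 (pd 1 f) u with hX
  -- `R` is the part of the Laplacian normal to the surface within `𝕊³ × ℝ`. Testing minimality
  -- against `R` itself gives `⟨R, R⟩ = 0`.
  set R := X + (1 + Real.cos θ ^ 2) • unitN (f u) with hR
  have nN : ∀ i, inner ℝ (pd i f u) (unitN (f u)) = (0 : ℝ) := fun i => by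
    rw [inner_eq_horiz, horiz_unitN, unitN_apply_four, ← d i u hu, mul_zero, add_zero,
      real_inner_comm]
    exact g_i i u hu
  have NN : inner ℝ (unitN (f u)) (unitN (f u)) = (1 : ℝ) := by
    rw [inner_eq_horiz, horiz_unitN, unitN_apply_four, mul_zero, add_zero]
    exact gg u hu
  have NX : inner ℝ (unitN (f u)) X = -(1 + Real.cos θ ^ 2) := by
    rw [inner_eq_horiz, horiz_unitN, unitN_apply_four, zero_mul, add_zero, hX, horiz_add,
      ← pd_pd_horiz ho hs hu, ← pd_pd_horiz ho hs hu, inner_add_right]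
    linarith
  have hxR : inner ℝ (pd 0 f u) R = (0 : ℝ) := by
    rw [hR, hX, inner_add_right, inner_add_right, inner_smul_right, nN]; linarith
  have hyR : inner ℝ (pd 1 f u) R = (0 : ℝ) := by
    rw [hR, hX, inner_add_right, inner_add_right, inner_smul_right, nN]; linarith
  have hNR : inner ℝ (unitN (f u)) R = (0 : ℝ) := by
    rw [hR, inner_add_right, inner_smul_right, NN, NX]; ring
  have hq := e.map_target hu
  have hmem : R ∈ normalPlane F (e.symm u) := by
    refine mem_normalPlane_iff.2 ⟨hNR, ?_⟩
    rw [tangentPlane_eq he hs hq, e.right_inv hu]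
    rintro _ ⟨z, rfl⟩
    change inner ℝ (fderiv ℝ f u z) R = (0 : ℝ)
    rw [fderiv_eq_pd, inner_add_left, inner_smul_left, inner_smul_left, hxR, hyR]
    simp
  have hXR : inner ℝ X R = (0 : ℝ) := by
    have := meanCurvature_eq_zero_iff (F := F) he hs hq (v := coordVec 0) (w := coordVec 1)
    rw [e.right_inv hu] at this
    have := (this (hxx u hu) (hxy u hu) (hyy u hu)).1 (hmin _) R hmem
    rwa [← hf, ← pd_pd_eq ho hs hu, ← pd_pd_eq ho hs hu] at this
  have hRR : inner ℝ R R = (0 : ℝ) := by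
    nth_rewrite 1 [hR]
    rw [inner_add_left, inner_smul_left, hXR, hNR]; simp
  have hR0 : R = 0 := inner_self_eq_zero.1 hRR
  have := congrArg horiz hR0
  rw [hR, hX, horiz_add, horiz_add, horiz_smul, horiz_unitN, ← pd_pd_horiz ho hs hu,
    ← pd_pd_horiz ho hs hu] at this
  rw [neg_smul]
  exact eq_neg_of_add_eq_zero_left this

theorem exists_flat_chart (hs : Real.sin θ ≠ 0) (hc : Real.cos θ ≠ 0) (hF : IsImmersed F)
    (hmin : IsMinimal F) (hang : HasConstantAngle F θ) (p : M) :
    ∃ e ∈ IsManifold.maximalAtlas (𝓡 2) ∞ M, p ∈ e.source ∧ IsPreconnected e.target ∧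
      FlatMinimal (Real.cos θ) (fun u => horiz (param F e u)) e.target ∧
      ∀ u ∈ e.target, param F e u 4 = Real.sin θ * u 0 := by
  have hφ := IsManifold.chart_mem_maximalAtlas (I := 𝓡 2) (n := ∞) p
  have hpφ := mem_chart_source Plane p
  set φ := chartAt Plane p
  have hA := angleSurface_param hF hmin hang hφ
  obtain ⟨V, hVU, huV, hV, ψ, sψ, hψ⟩ := hA.exists_coordinates hs hc (φ.map_source hpφ)
  have hinj : ∀ u ∈ V, Function.Injective (fderiv ℝ ψ u) := fun u hu => by
    rw [injective_iff_map_eq_zero]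
    intro z hz
    have := (hψ u hu).2 z
    rw [hz, norm_zero, norm_eq_zero] at this
    exact hA.injective u (hVU hu) (by rw [this, map_zero])
  obtain ⟨τ, hτu, hτV, hτψ, hτs⟩ := exists_openPartialHomeomorph hV sψ hinj huV
  have hτψ' : (τ : Plane → Plane) = ψ := funext hτψ
  have hτ : ContDiffOn ℝ ∞ τ τ.source := by rw [hτψ']; exact sψ.mono hτV
  set e₁ := φ.trans τ with he₁
  have he₁m := trans_mem_maximalAtlas hφ hτ hτs
  have hp₁ : p ∈ e₁.source := ⟨hpφ, hτu⟩
  -- The chart is cut down to one whose image is a ball, since constancy of `a` and `b` needs a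
  -- connected domain.
  obtain ⟨r, hr, hrU⟩ := Metric.isOpen_iff.1 e₁.open_target _ (e₁.map_source hp₁)
  set B := Metric.ball (e₁ p) r
  set e := e₁.trans (OpenPartialHomeomorph.ofSet B Metric.isOpen_ball) with he
  have hem : e ∈ IsManifold.maximalAtlas (𝓡 2) ∞ M :=
    trans_mem_maximalAtlas he₁m contDiffOn_id contDiffOn_id
  have htar : e.target = B := by
    ext u
    simp only [he, OpenPartialHomeomorph.trans_target, OpenPartialHomeomorph.ofSet_target,
      OpenPartialHomeomorph.ofSet_symm, Set.mem_inter_iff, Set.mem_preimage,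
      OpenPartialHomeomorph.ofSet_apply, id]
    exact ⟨fun h => h.1, fun h => ⟨h, hrU h⟩⟩
  have hpar : ∀ u, param F e u = param F φ (τ.symm u) := fun u => rfl
  have hsub : ∀ u ∈ e.target, u ∈ τ.target := fun u hu => (hrU (htar ▸ hu)).1
  have h4 : ∀ u ∈ e.target, param F e u 4 = Real.sin θ * u 0 := fun u hu => by
    rw [hpar, (hψ _ (hτV (τ.map_target (hsub u hu)))).1, ← hτψ, τ.right_inv (hsub u hu)]
  have hiso : ∀ u ∈ e.target, ∀ z, ‖fderiv ℝ (param F e) u z‖ = ‖z‖ := fun u hu z => by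
    have hu' := hτV (τ.map_target (hsub u hu))
    have d1 := differentiableAt_of_contDiffOn τ.open_target hτs (hsub u hu)
    have d2 := differentiableAt_of_contDiffOn hA.isOpen hA.smooth (hVU hu')
    have d3 := differentiableAt_of_contDiffOn hV sψ hu'
    have e1 : fderiv ℝ (param F e) u z
        = fderiv ℝ (param F φ) (τ.symm u) (fderiv ℝ τ.symm u z) :=
      congrArg (fun A : Plane →L[ℝ] E5 => A z) (fderiv_comp u d2 d1)
    have e2 : fderiv ℝ ψ (τ.symm u) (fderiv ℝ τ.symm u z) = z := by
      have h1 := fderiv_comp u d3 d1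
      have h2 : ψ ∘ τ.symm =ᶠ[nhds u] id := by
        filter_upwards [τ.open_target.mem_nhds (hsub u hu)] with x hx
        rw [← hτψ', Function.comp_apply, τ.right_inv hx, id]
      rw [h2.fderiv_eq, fderiv_id] at h1
      exact (congrArg (fun A : Plane →L[ℝ] Plane => A z) h1).symm
    rw [e1, (hψ _ hu').2, e2]
  exact ⟨e, hem, ⟨hp₁, Metric.mem_ball_self hr⟩,
    htar ▸ (convex_ball _ _).isPreconnected, flatMinimal_of_isometric hF hmin hem hiso h4, h4⟩

/-- Minimal surfaces of constant angle are locally given by the explicit maps. -/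
theorem exists_isModelNear (hs : 0 < Real.sin θ) (hc : 0 < Real.cos θ) (hF : IsImmersed F)
    (hmin : IsMinimal F) (hang : HasConstantAngle F θ) (p : M) :
    ∃ ν ∈ Set.Icc 1 (√(1 + Real.cos θ ^ 2)), ∃ Φ : Isom, IsModelNear F Φ θ ν p := by
  obtain ⟨e, he, hp, hpre, hfm, h4⟩ := exists_flat_chart hs.ne' hc.ne' hF hmin hang p
  have hu := e.map_source hp
  obtain ⟨h1, h2⟩ := hfm.sq_add_sq hc.ne' hpre hu
  obtain ⟨ν, hν, hr⟩ := exists_parameter hc h1 h2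
  obtain ⟨L, hL⟩ := hfm.exists_isometry_or_reflect (flatMinimal_modelS3 hc hν) hc.ne' hpre hu
    (hr 0).symm
  refine ⟨ν, hν, Isom.ofLinearIsometry L, ?_⟩
  have hpar : ∀ q ∈ e.source, param F e (e q) = F q := fun q hq => param_apply F hq
  rcases hL with hL | hL
  · refine ⟨e, he, hp, fun q hq => ?_⟩
    have hq' := e.map_source hq
    rw [model_eq, ← hL _ hq', hpar q hq]
    refine ext_horiz ?_ ?_
    · rw [Isom.horiz_ofLinearIsometry, horiz_pair]
    · rw [Isom.ofLinearIsometry_apply_four, pair_apply_four, ← hpar q hq, h4 _ hq', mul_comm]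
  -- The reflection enters the coordinates rather than the isometry. It fixes `x`, so the height is
  -- unaffected.
  · refine ⟨e.trans reflect.toHomeomorph.toOpenPartialHomeomorph,
      trans_mem_maximalAtlas he reflect.contDiff.contDiffOn reflect.symm.contDiff.contDiffOn,
      ⟨hp, trivial⟩, fun q hq => ?_⟩
    have hq := hq.1
    have hq' := e.map_source hq
    change _ = model θ ν (reflect (e q) 0) (reflect (e q) 1)
    rw [model_eq, ← hL _ hq', hpar q hq]
    refine ext_horiz ?_ ?_
    · rw [Isom.horiz_ofLinearIsometry, horiz_pair]
    · rw [Isom.ofLinearIsometry_apply_four, pair_apply_four, ← hpar q hq, h4 _ hq', mul_comm,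
        reflect_apply_zero]

end S3R

/-! ### Connected surfaces: one model for all points -/

namespace S3R

/-- The map `(x, y) ↦ (κx + x₀, λy + y₀)` of the plane, for signs `κ` and `λ`. -/
noncomputable def signedTranslation {κ l : ℝ} (hκ : κ ^ 2 = 1) (hl : l ^ 2 = 1) (x₀ y₀ : ℝ) :
    Plane ≃ₜ Plane where
  toFun u := !₂[κ * u 0 + x₀, l * u 1 + y₀]
  invFun u := !₂[κ * (u 0 - x₀), l * (u 1 - y₀)]
  left_inv u := by
    ext i; fin_cases i
    · simp; linear_combination u 0 * hκ
    · simp; linear_combination u 1 * hl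
  right_inv u := by
    ext i; fin_cases i
    · simp; linear_combination (u 0 - x₀) * hκ
    · simp; linear_combination (u 1 - y₀) * hl
  continuous_toFun := by fun_prop
  continuous_invFun := by fun_prop

theorem contDiff_signedTranslation {κ l : ℝ} (hκ : κ ^ 2 = 1) (hl : l ^ 2 = 1) (x₀ y₀ : ℝ)
    {n : WithTop ℕ∞} : ContDiff ℝ n (signedTranslation hκ hl x₀ y₀) ∧
      ContDiff ℝ n (signedTranslation hκ hl x₀ y₀).symm := by
  constructor <;> rw [contDiff_euclidean] <;> intro i <;> fin_cases i <;>
    simp [signedTranslation] <;> fun_prop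

theorem contDiff_modelS3 (θ ν : ℝ) {n : WithTop ℕ∞} : ContDiff ℝ n (modelS3 θ ν) := by
  rw [modelS3_eq]; exact contDiff_torus _ _ _ _

theorem FlatMinimal.inner_fderiv {c : ℝ} {g : Plane → E4} {U : Set Plane} (h : FlatMinimal c g U)
    {u : Plane} (hu : u ∈ U) (z : Plane) :
    inner ℝ (fderiv ℝ g u z) (fderiv ℝ g u z) = c ^ 2 * z 0 ^ 2 + z 1 ^ 2 := by
  have hyx : inner ℝ (pd 1 g u) (pd 0 g u) = (0 : ℝ) := by rw [real_inner_comm, h.xy u hu]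
  rw [fderiv_eq_pd]
  simp only [inner_add_left, inner_add_right, inner_smul_left, inner_smul_right, h.xx u hu,
    h.xy u hu, h.yy u hu, hyx, conj_trivial]
  ring

/-- A local congruence between flat minimal maps which preserves the first coordinate up to sign
and translation is a signed translation. -/
theorem exists_eq_signedTranslation {c : ℝ} {g g' : Plane → E4} {κ x₀ : ℝ} (hκ : κ ^ 2 = 1)
    (hg : FlatMinimal c g Set.univ) (hg' : FlatMinimal c g' Set.univ) {L : E4 ≃ₗᵢ[ℝ] E4}
    {τ : Plane → Plane} {u₀ : Plane} (hτ : ContDiffAt ℝ ∞ τ u₀)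
    (h : ∀ᶠ u in nhds u₀, τ u 0 = κ * u 0 + x₀ ∧ g (τ u) = L (g' u)) :
    ∃ (l y₀ : ℝ) (hl : l ^ 2 = 1), ∀ᶠ u in nhds u₀, τ u = signedTranslation hκ hl x₀ y₀ u := by
  have h2 : (2 : WithTop ℕ∞) ≤ ∞ := by simpa using WithTop.coe_le_coe.2 (le_top (a := (2 : ℕ∞)))
  obtain ⟨r, hr, hB⟩ := Metric.eventually_nhds_iff_ball.1
    (h.and ((hτ.of_le h2).eventually (by simp)))
  set B := Metric.ball u₀ r
  have hBo : IsOpen B := Metric.isOpen_ball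
  have hBc : IsPreconnected B := (convex_ball u₀ r).isPreconnected
  have dτ : ∀ u ∈ B, DifferentiableAt ℝ τ u := fun u hu =>
    (hB u hu).2.differentiableAt (by simp)
  set t : Plane → ℝ := fun u => τ u 1 with ht
  -- Both maps induce the metric `c² dx² + dy²`, and `τ` already preserves `dx²`. So it preserves
  -- `dy²`.
  have hsq : ∀ u ∈ B, ∀ i, (pd i t u) ^ 2 = coordVec i 1 ^ 2 := by
    intro u hu i
    have p0 : pd i τ u 0 = κ * coordVec i 0 := by
      rw [pd_apply (dτ u hu), pd_congr hBo (fun v hv => (hB v hv).1.1) hu, pd_affine]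
      fin_cases i <;> simp [coordVec]
    have p1 : pd i τ u 1 = pd i t u := pd_apply (dτ u hu) i 1
    have dg := differentiableAt_of_contDiffOn isOpen_univ hg.smooth (Set.mem_univ (τ u))
    have h1 : fderiv ℝ (fun u => g (τ u)) u (coordVec i) = fderiv ℝ g (τ u) (pd i τ u) :=
      congrArg (fun A : Plane →L[ℝ] E4 => A (coordVec i)) (fderiv_comp u dg (dτ u hu))
    have h3 : fderiv ℝ (fun u => L (g' u)) u (coordVec i) = L (fderiv ℝ g' u (coordVec i)) :=
      congrArg (fun A : Plane →L[ℝ] E4 => A (coordVec i))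
        (L.toContinuousLinearEquiv.comp_fderiv (f := g') (x := u))
    have h4 := pd_congr hBo (fun v hv => (hB v hv).1.2) hu i
    have h5 := congrArg (fun x : E4 => (inner ℝ x x : ℝ)) (h1.symm.trans (h4.trans h3))
    simp only [L.inner_map_map, hg.inner_fderiv (Set.mem_univ _),
      hg'.inner_fderiv (Set.mem_univ _), p0, p1] at h5
    linear_combination h5 - c ^ 2 * coordVec i 0 ^ 2 * hκ
  have hcont : ContinuousOn (pd 1 t) B := by
    have : ContDiffOn ℝ 2 t B := fun u hu =>
      ((contDiffAt_euclidean.1 (hB u hu).2) 1).contDiffWithinAt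
    exact ((this.continuousOn_fderiv_of_isOpen hBo (by norm_num)).clm_apply continuousOn_const)
  -- A continuous function with square `1` on a connected ball has constant sign.
  obtain ⟨l, hl, hlB⟩ : ∃ l : ℝ, l ^ 2 = 1 ∧ ∀ u ∈ B, pd 1 t u = l := by
    have hsq1 : ∀ u ∈ B, (pd 1 t u) ^ 2 = 1 := fun u hu => by
      rw [hsq u hu]; simp [coordVec]
    rcases hBc.eq_one_or_eq_neg_one_of_sq_eq hcont (fun u hu => hsq1 u hu) with h | h
    · exact ⟨1, by norm_num, fun u hu => h hu⟩
    · exact ⟨-1, by norm_num, fun u hu => h hu⟩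
  have hpd0 : ∀ u ∈ B, pd 0 t u = 0 := fun u hu => by
    have := hsq u hu 0
    simpa [coordVec] using this
  have dt : ∀ u ∈ B, DifferentiableAt ℝ t u := fun u hu =>
    ((contDiffAt_euclidean.1 (hB u hu).2) 1).differentiableAt (by simp)
  obtain ⟨y₀, hy₀⟩ := hBo.exists_is_const_of_fderiv_eq_zero (f := fun u => t u - phase 0 l u) hBc
    (fun u hu => ((dt u hu).sub (phase 0 l).differentiableAt).differentiableWithinAt)
    fun u hu => fderiv_eq_zero_of_pd fun i => by
      rw [pd, fderiv_fun_sub (dt u hu) (phase 0 l).differentiableAt,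
        ContinuousLinearMap.fderiv, sub_apply, phase_coordVec]
      fin_cases i
      · simpa [pd] using hpd0 u hu
      · simpa [sub_eq_zero, pd] using hlB u hu
  refine ⟨l, y₀, hl, Metric.eventually_nhds_iff_ball.2 ⟨r, hr, fun u hu => ?_⟩⟩
  have h1 := hy₀ u hu
  rw [phase_apply] at h1
  ext i
  fin_cases i
  · exact (hB u hu).1.1
  · change t u = l * u 1 + y₀
    linarith

variable {M : Type*} [TopologicalSpace M] [ChartedSpace Plane M] [IsManifold (𝓡 2) ∞ M]
  {F : M → S3xR} {θ : ℝ}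

/-- If the explicit map with parameters `Φ`, `ν` represents the surface near one point of a chart
in which the surface is given by some explicit map, then it does so near all points of the chart. -/
theorem IsModelNear.of_mem_source {Φ Ψ : Isom} {ν ν' : ℝ} (hs : 0 < Real.sin θ)
    (hc : 0 < Real.cos θ) (hν : ν ∈ Set.Icc 1 (√(1 + Real.cos θ ^ 2)))
    (hν' : ν' ∈ Set.Icc 1 (√(1 + Real.cos θ ^ 2))) {r q : M} (hr : IsModelNear F Φ θ ν r)
    {e' : OpenPartialHomeomorph M Plane} (he' : e' ∈ IsManifold.maximalAtlas (𝓡 2) ∞ M)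
    (hre' : r ∈ e'.source)
    (hΨ : ∀ q ∈ e'.source, (Ψ.toEquiv (F q) : E5) = model θ ν' (e' q 0) (e' q 1))
    (hq : q ∈ e'.source) : IsModelNear F Φ θ ν q := by
  obtain ⟨e, he, hre, hΦ⟩ := hr
  obtain ⟨L₁, ε₁, τ₁, hε₁, hL₁⟩ := Φ.exists_eq
  obtain ⟨L₂, ε₂, τ₂, hε₂, hL₂⟩ := Ψ.exists_eq
  -- `L`, `κ` and `x₀` describe `Φ ∘ Ψ⁻¹`: its orthogonal part, and its action on the line written
  -- in terms of `x = t / sin θ`.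
  set L := L₂.symm.trans L₁ with hL
  set κ := ε₁ * ε₂ with hκ'
  have hκ : κ ^ 2 = 1 := by rw [hκ', mul_pow, hε₁, hε₂, one_mul]
  set x₀ := (τ₁ - κ * τ₂) / Real.sin θ with hx₀
  have key : ∀ x ∈ e'.source, horiz (Φ.toEquiv (F x)) = L (modelS3 θ ν' (e' x)) ∧
      (Φ.toEquiv (F x) : E5) 4 = (κ * e' x 0 + x₀) * Real.sin θ := by
    intro x hx
    have h1 := hΨ x hx
    rw [model_eq] at h1
    have h2 := hL₂ (F x)
    rw [h1, horiz_pair, pair_apply_four] at h2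
    have h3 := hL₁ (F x)
    refine ⟨?_, ?_⟩
    · rw [h3.1, h2.1, hL]; simp
    · rw [h3.2, hx₀, add_mul, div_mul_cancel₀ _ hs.ne', hκ']
      linear_combination -(ε₁ * ε₂) * h2.2 - ε₁ * (F x : E5) 4 * hε₂
  have hτ := contDiffAt_transition he he' hre hre'
  have hev : ∀ᶠ u in nhds (e' r), (e ∘ e'.symm) u 0 = κ * u 0 + x₀ ∧
      modelS3 θ ν ((e ∘ e'.symm) u) = L (modelS3 θ ν' u) := by
    filter_upwards [eventually_symm_mem_source hre hre'] with u hu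
    have h1 := key _ (e'.map_target hu.1)
    have h2 := hΦ _ hu.2
    rw [e'.right_inv hu.1, h2, model_eq, horiz_pair, pair_apply_four] at h1
    exact ⟨mul_right_cancel₀ hs.ne' h1.2, h1.1⟩
  obtain ⟨l, y₀, hl, hσ⟩ := exists_eq_signedTranslation hκ (flatMinimal_modelS3 hc hν)
    (flatMinimal_modelS3 hc hν') hτ hev
  set σ := signedTranslation hκ hl x₀ y₀ with hσ'
  -- Both sides are analytic on the whole plane and agree near `e' r`, hence everywhere. So `e'`
  -- followed by `σ` represents the surface by `Φ` and `ν` on the whole source of `e'`, connected or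
  -- not; `ν = ν'` is not needed.
  have han : (fun u => modelS3 θ ν (σ u)) = fun u => L (modelS3 θ ν' u) := by
    have c1 : ContDiff ℝ ω (fun u => modelS3 θ ν (σ u)) :=
      (contDiff_modelS3 θ ν).comp (contDiff_signedTranslation hκ hl x₀ y₀).1
    have c2 : ContDiff ℝ ω (fun u => L (modelS3 θ ν' u)) :=
      L.toContinuousLinearEquiv.contDiff.comp (contDiff_modelS3 θ ν')
    refine AnalyticOnNhd.eq_of_eventuallyEq (z₀ := e' r) (fun u _ => c1.contDiffAt.analyticAt)
      (fun u _ => c2.contDiffAt.analyticAt) ?_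
    filter_upwards [hσ, hev] with u h1 h2
    rw [← h1, h2.2]
  refine ⟨e'.trans σ.toOpenPartialHomeomorph, trans_mem_maximalAtlas he'
    (contDiff_signedTranslation hκ hl x₀ y₀).1.contDiffOn
    (contDiff_signedTranslation hκ hl x₀ y₀).2.contDiffOn, ⟨hq, trivial⟩, fun x hx => ?_⟩
  obtain ⟨h1, h2⟩ := key x hx.1
  change _ = model θ ν (σ (e' x) 0) (σ (e' x) 1)
  rw [model_eq]
  refine ext_horiz ?_ ?_
  · rw [h1, horiz_pair]; exact (congrFun han (e' x)).symm
  · rw [h2, pair_apply_four]; rfl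

/-- For a representation chosen at one point, the set where it is valid is open by definition. It is
closed because near a limit point some other representation exists, and `IsModelNear.of_mem_source`
transfers the chosen one across its chart. -/
theorem exists_forall_isModelNear [ConnectedSpace M] (hs : 0 < Real.sin θ) (hc : 0 < Real.cos θ)
    (h : ∀ p : M, ∃ ν ∈ Set.Icc 1 (√(1 + Real.cos θ ^ 2)), ∃ Φ : Isom,
      IsModelNear F Φ θ ν p) :
    ∃ ν ∈ Set.Icc 1 (√(1 + Real.cos θ ^ 2)), ∃ Φ : Isom, ∀ p, IsModelNear F Φ θ ν p := by
  obtain ⟨p₀⟩ := (inferInstance : Nonempty M)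
  obtain ⟨ν, hν, Φ, hp₀⟩ := h p₀
  refine ⟨ν, hν, Φ, fun p => ?_⟩
  have hclopen : IsClopen {p | IsModelNear F Φ θ ν p} := by
    constructor
    · refine isClosed_of_closure_subset fun q hq => ?_
      obtain ⟨ν', hν', Ψ, e', he', hqe', hΨ⟩ := h q
      obtain ⟨r, hr, hrS⟩ := mem_closure_iff.1 hq _ e'.open_source hqe'
      exact IsModelNear.of_mem_source hs hc hν hν' hrS he' hr hΨ hqe'
    · refine isOpen_iff_mem_nhds.2 fun q hq => ?_
      obtain ⟨e, he, hqe, hΦ⟩ := hq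
      filter_upwards [e.open_source.mem_nhds hqe] with x hx
      exact ⟨e, he, hx, hΦ⟩
  have := hclopen.eq_univ ⟨p₀, hp₀⟩
  exact Set.eq_univ_iff_forall.1 this p

end S3R

theorem theorem2 {M : Type*} [TopologicalSpace M] [ChartedSpace S3R.Plane M]
    [IsManifold (𝓡 2) ∞ M] (F : M → S3R.S3xR) (θ : ℝ) (hθ : θ ∈ Set.Ioo 0 (Real.pi / 2)) :
    ((S3R.IsImmersed F ∧ S3R.IsMinimal F ∧ S3R.HasConstantAngle F θ) ↔
      ∀ p : M, ∃ ν₁ ∈ Set.Icc 1 (√(1 + Real.cos θ ^ 2)), ∃ Φ : S3R.Isom,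
        S3R.IsModelNear F Φ θ ν₁ p) ∧
    (ConnectedSpace M →
      ((S3R.IsImmersed F ∧ S3R.IsMinimal F ∧ S3R.HasConstantAngle F θ) ↔
        ∃ ν₁ ∈ Set.Icc 1 (√(1 + Real.cos θ ^ 2)), ∃ Φ : S3R.Isom,
          ∀ p : M, S3R.IsModelNear F Φ θ ν₁ p)) := by
  have hs : 0 < Real.sin θ := Real.sin_pos_of_pos_of_lt_pi hθ.1 (by linarith [hθ.2, Real.pi_pos])
  have hc : 0 < Real.cos θ := Real.cos_pos_of_mem_Ioo ⟨by linarith [hθ.1, Real.pi_pos], hθ.2⟩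
  have main : (S3R.IsImmersed F ∧ S3R.IsMinimal F ∧ S3R.HasConstantAngle F θ) ↔
      ∀ p : M, ∃ ν₁ ∈ Set.Icc 1 (√(1 + Real.cos θ ^ 2)), ∃ Φ : S3R.Isom,
        S3R.IsModelNear F Φ θ ν₁ p :=
    ⟨fun h p => S3R.exists_isModelNear hs hc h.1 h.2.1 h.2.2 p, S3R.minimal_of_isModelNear hc⟩
  refine ⟨main, fun _ => main.trans ⟨S3R.exists_forall_isModelNear hs hc, ?_⟩⟩
  rintro ⟨ν, hν, Φ, h⟩ p
  exact ⟨ν, hν, Φ, h p⟩
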